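/- Let $k$ be an algebraically closed field and $Q$ a finite quiver. Write paths from right to left: for paths $p,q$ with $s(p)=t(q)$, where $s$ and $t$ denote the starting and the ending vertex, $pq$ is the path "first $q$, then $p$". Let $I$ be a monomial ideal of the path algebra $kQ$, that is, an ideal generated by some paths of length at least two which is admissible (with $J$ the ideal generated by the arrows, $J^m\subseteq I\subseteq J^2$ for some $m\ge 2$), and let $A=kQ/I$. A path is called nonzero (in $A$) if it does not belong to $I$, and $\mathbf F$ is the set of minimal paths in $I$, i.e. of those paths in $I$ that have no proper subpath in $I$. A pair $(p,q)$ of nonzero paths is perfect if (P1) $p$ and $q$ have positive length, $s(p)=t(q)$, and $pq=0$ in $A$; (P2) whenever $q'$ is a nonzero path with $t(q')=s(p)$ and $pq'=0$ in $A$, then $q'=qq''$ for some path $q''$; (P3) whenever $p'$ is a nonzero path with $s(p')=t(q)$ and $p'q=0$ in $A$, then $p'=p''p$ for some path $p''$. A nonzero path $p$ is perfect if there are $n\ge1$ and nonzero paths $p=p_1,p_2,\dots,p_n,p_{n+1}=p$ such that $(p_i,p_{i+1})$ is a perfect pair for all $1\le i\le n$. The algebra $A$ is $1$-Gorenstein if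 its injective dimensions as a left and as a right module over itself are both at most $1$. Then $A$ is $1$-Gorenstein if and only if every nonzero path $p$ for which there exists a nonzero path $q$ with $s(p)=t(q)$ and $pq\in\mathbf F$ is a perfect path. -/

import Mathlib

universe w u v

namespace BoundQuiver

/-- A path in the quiver `Q`, together with its starting vertex `src` and its ending vertex `tgt`
(the paths of length zero are the `⟨i, i, Quiver.Path.nil⟩`). -/
@[ext]
structure QPath (Q : Type u) [Quiver.{v} Q] where
  src : Q
  tgt : Q
  path : Quiver.Path src tgt

namespace QPath

variable {Q : Type u} [Quiver.{v} Q]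

/-- The length of a path, i.e. its number of arrows. -/
def length (p : QPath Q) : ℕ := p.path.length

/-- The path `e_i` of length zero at the vertex `i`. -/
def idem (i : Q) : QPath Q := ⟨i, i, Quiver.Path.nil⟩

/-- For two paths `p`, `q` with `s(p) = t(q)` the concatenation `pq`: first `q`, then `p`. -/
def concat (p q : QPath Q) (h : q.tgt = p.src) : QPath Q :=
  ⟨q.src, p.tgt, (q.path.cast rfl h).comp p.path⟩

/-- `p` is a subpath of `q`: `q = p'' p p'` for some paths `p''` and `p'`. -/
def IsSubpath (p q : QPath Q) : Prop :=
  ∃ (p'' p' : QPath Q) (h' : p'.tgt = p.src) (h'' : p.tgt = p''.src),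
    q = p''.concat (p.concat p' h') h''

theorem concat_assoc (p q r : QPath Q) (h : q.tgt = p.src) (h' : r.tgt = q.src) :
    (p.concat q h).concat r h' = p.concat (q.concat r h') h := by
  obtain ⟨a, b, p⟩ := p
  obtain ⟨c, d, q⟩ := q
  obtain ⟨e, f, r⟩ := r
  dsimp only at h h'
  subst h h'
  simp [concat, Quiver.Path.comp_assoc]

theorem idem_concat (p : QPath Q) {i : Q} (h : p.tgt = i) : (idem i).concat p h = p := by
  subst h
  simp [idem, concat]

theorem concat_idem (p : QPath Q) {i : Q} (h : i = p.src) : p.concat (idem i) h = p := by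
  subst h
  simp [idem, concat]

end QPath

/-- The path algebra `kQ`: the `k`-vector space with basis the set of all paths of `Q`. -/
def PathAlgebra (k : Type w) [Field k] (Q : Type u) [Quiver.{v} Q] : Type (max u v w) :=
  QPath Q →₀ k

namespace PathAlgebra

noncomputable section

variable {k : Type w} [Field k] {Q : Type u} [Quiver.{v} Q]

instance : AddCommGroup (PathAlgebra k Q) := inferInstanceAs (AddCommGroup (QPath Q →₀ k))

instance : Module k (PathAlgebra k Q) := inferInstanceAs (Module k (QPath Q →₀ k))

/-- The basis element of `kQ` given by a path. -/
def ofPath (k : Type w) [Field k] {Q : Type u} [Quiver.{v} Q] (p : QPath Q) : PathAlgebra k Q :=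
  Finsupp.single p (1 : k)

/-- The basis of `kQ` formed by the paths. -/
def basis (k : Type w) [Field k] (Q : Type u) [Quiver.{v} Q] :
    Module.Basis (QPath Q) k (PathAlgebra k Q) :=
  Module.Basis.ofRepr (LinearEquiv.refl k (QPath Q →₀ k))

theorem basis_apply (p : QPath Q) : basis k Q p = ofPath k p := rfl

open Classical in
/-- The product of two paths in `kQ`: their concatenation `pq` if `s(p) = t(q)`, else `0`. -/
def basisMul (k : Type w) [Field k] {Q : Type u} [Quiver.{v} Q] (p q : QPath Q) :
    PathAlgebra k Q :=
  if h : q.tgt = p.src then ofPath k (p.concat q h) else 0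

/-- The multiplication of `kQ`: the bilinear extension of the product of paths. -/
def mulBilin (k : Type w) [Field k] (Q : Type u) [Quiver.{v} Q] :
    PathAlgebra k Q →ₗ[k] PathAlgebra k Q →ₗ[k] PathAlgebra k Q :=
  (basis k Q).constr k fun p => (basis k Q).constr k fun q => basisMul k p q

instance : Mul (PathAlgebra k Q) := ⟨fun x y => mulBilin k Q x y⟩

/-- The identity of `kQ` is the sum of the paths of length zero (`Q` has finitely many vertices). -/
instance [Fintype Q] : One (PathAlgebra k Q) := ⟨∑ i : Q, ofPath k (QPath.idem i)⟩

theorem mul_def (x y : PathAlgebra k Q) : x * y = mulBilin k Q x y := rfl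

theorem one_def [Fintype Q] :
    (1 : PathAlgebra k Q) = ∑ i : Q, ofPath k (QPath.idem i) := rfl

theorem induction_on {P : PathAlgebra k Q → Prop} (x : PathAlgebra k Q) (h0 : P 0)
    (hadd : ∀ x y, P x → P y → P (x + y)) (hs : ∀ (c : k) p, P (c • ofPath k p)) : P x := by
  refine Finsupp.induction_linear (motive := P) x h0 hadd fun p c => ?_
  have h : (Finsupp.single p c : QPath Q →₀ k) = c • Finsupp.single p (1 : k) := by
    rw [Finsupp.smul_single, smul_eq_mul, mul_one]
  rw [h]
  exact hs c p

theorem ofPath_mul_ofPath (p q : QPath Q) : ofPath k p * ofPath k q = basisMul k p q := by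
  rw [mul_def, mulBilin, ← basis_apply, ← basis_apply, Module.Basis.constr_basis,
    Module.Basis.constr_basis]

theorem smul_mul' (c : k) (x y : PathAlgebra k Q) : (c • x) * y = c • (x * y) := by
  simp only [mul_def, map_smul, LinearMap.smul_apply]

theorem mul_smul' (c : k) (x y : PathAlgebra k Q) : x * (c • y) = c • (x * y) := by
  simp only [mul_def, map_smul]

theorem add_mul' (x y z : PathAlgebra k Q) : (x + y) * z = x * z + y * z := by
  simp only [mul_def, map_add, LinearMap.add_apply]

theorem mul_add' (x y z : PathAlgebra k Q) : x * (y + z) = x * y + x * z := by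
  simp only [mul_def, map_add]

theorem zero_mul' (x : PathAlgebra k Q) : 0 * x = 0 := by
  simp only [mul_def, map_zero, LinearMap.zero_apply]

theorem mul_zero' (x : PathAlgebra k Q) : x * 0 = 0 := by
  simp only [mul_def, map_zero]

theorem mul_assoc_ofPath (p q r : QPath Q) :
    (ofPath k p * ofPath k q) * ofPath k r = ofPath k p * (ofPath k q * ofPath k r) := by
  rw [ofPath_mul_ofPath, ofPath_mul_ofPath]
  by_cases h : q.tgt = p.src
  · by_cases h' : r.tgt = q.src
    · have h1 : r.tgt = (p.concat q h).src := h'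
      have h2 : (q.concat r h').tgt = p.src := h
      rw [basisMul, dif_pos h, basisMul, dif_pos h', ofPath_mul_ofPath, ofPath_mul_ofPath,
        basisMul, dif_pos h1, basisMul, dif_pos h2]
      exact congrArg (ofPath k) (QPath.concat_assoc p q r h h')
    · have h1 : ¬ r.tgt = (p.concat q h).src := h'
      rw [basisMul, dif_pos h, basisMul, dif_neg h', ofPath_mul_ofPath, basisMul, dif_neg h1,
        mul_zero']
  · by_cases h' : r.tgt = q.src
    · have h2 : ¬ (q.concat r h').tgt = p.src := h
      rw [basisMul, dif_neg h, basisMul, dif_pos h', ofPath_mul_ofPath, basisMul, dif_neg h2,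
        zero_mul']
    · rw [basisMul, dif_neg h, basisMul, dif_neg h', zero_mul', mul_zero']

theorem mul_assoc' (x y z : PathAlgebra k Q) : x * y * z = x * (y * z) := by
  induction x using induction_on with
  | h0 => simp only [zero_mul']
  | hadd x₁ x₂ h₁ h₂ => simp only [add_mul', h₁, h₂]
  | hs c p =>
    induction y using induction_on with
    | h0 => simp only [zero_mul', mul_zero']
    | hadd y₁ y₂ h₁ h₂ => simp only [add_mul', mul_add', h₁, h₂]
    | hs d q =>
      induction z using induction_on with
      | h0 => simp only [mul_zero']
      | hadd z₁ z₂ h₁ h₂ => simp only [mul_add', h₁, h₂]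
      | hs e r => simp only [smul_mul', mul_smul', mul_assoc_ofPath]

theorem one_mul' [Fintype Q] (x : PathAlgebra k Q) : 1 * x = x := by
  induction x using induction_on with
  | h0 => rw [mul_zero']
  | hadd x y hx hy => rw [mul_add', hx, hy]
  | hs c p =>
    have h1 : ofPath k (QPath.idem p.tgt) * ofPath k p = ofPath k p := by
      have h : p.tgt = (QPath.idem p.tgt).src := rfl
      rw [ofPath_mul_ofPath, basisMul, dif_pos h]
      exact congrArg (ofPath k) (QPath.idem_concat p rfl)
    have h2 : ∀ i ≠ p.tgt, ofPath k (QPath.idem i) * ofPath k p = 0 := fun i hi => by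
      have h : ¬ p.tgt = (QPath.idem i).src := fun h => hi h.symm
      rw [ofPath_mul_ofPath, basisMul, dif_neg h]
    rw [mul_smul', one_def, mul_def, map_sum, LinearMap.sum_apply, Finset.sum_eq_single p.tgt]
    · rw [← mul_def, h1]
    · exact fun i _ hi => h2 i hi
    · exact fun h => absurd (Finset.mem_univ _) h

theorem mul_one' [Fintype Q] (x : PathAlgebra k Q) : x * 1 = x := by
  induction x using induction_on with
  | h0 => rw [zero_mul']
  | hadd x y hx hy => rw [add_mul', hx, hy]
  | hs c p =>
    have h1 : ofPath k p * ofPath k (QPath.idem p.src) = ofPath k p := by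
      have h : (QPath.idem p.src).tgt = p.src := rfl
      rw [ofPath_mul_ofPath, basisMul, dif_pos h]
      exact congrArg (ofPath k) (QPath.concat_idem p rfl)
    have h2 : ∀ i ≠ p.src, ofPath k p * ofPath k (QPath.idem i) = 0 := fun i hi => by
      have h : ¬ (QPath.idem i).tgt = p.src := fun h => hi h
      rw [ofPath_mul_ofPath, basisMul, dif_neg h]
    rw [smul_mul', one_def, mul_def, map_sum, Finset.sum_eq_single p.src]
    · rw [← mul_def, h1]
    · exact fun i _ hi => h2 i hi
    · exact fun h => absurd (Finset.mem_univ _) h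

instance [Fintype Q] : Ring (PathAlgebra k Q) :=
  { (inferInstance : AddCommGroup (PathAlgebra k Q)) with
    mul := (· * ·)
    one := 1
    left_distrib := mul_add'
    right_distrib := add_mul'
    zero_mul := zero_mul'
    mul_zero := mul_zero'
    mul_assoc := mul_assoc'
    one_mul := one_mul'
    mul_one := mul_one' }

instance [Fintype Q] : Algebra k (PathAlgebra k Q) :=
  Algebra.ofModule smul_mul' mul_smul'

end

end PathAlgebra

section Monomial

variable {k : Type w} [Field k] {Q : Type u} [Quiver.{v} Q] [Fintype Q]

open PathAlgebra

/-- The power `J ^ m` of the arrow ideal `J` of `kQ`: the ideal generated by the paths of length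
at least `m`. -/
noncomputable def arrowIdealPow (k : Type w) [Field k] (Q : Type u) [Quiver.{v} Q] [Fintype Q]
    (m : ℕ) :
    TwoSidedIdeal (PathAlgebra k Q) :=
  TwoSidedIdeal.span (ofPath k '' {p : QPath Q | m ≤ p.length})

/-- The ideal `I` of `kQ` is admissible: `J ^ m ⊆ I ⊆ J ^ 2` for some `m ≥ 2`. -/
def IsAdmissible (I : TwoSidedIdeal (PathAlgebra k Q)) : Prop :=
  (∃ m : ℕ, 2 ≤ m ∧ arrowIdealPow k Q m ≤ I) ∧ I ≤ arrowIdealPow k Q 2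

/-- The admissible ideal `I` of `kQ` is monomial: it is generated by some paths of length at least
two. -/
def IsMonomial (I : TwoSidedIdeal (PathAlgebra k Q)) : Prop :=
  IsAdmissible I ∧
    ∃ S : Set (QPath Q), (∀ p ∈ S, 2 ≤ p.length) ∧ I = TwoSidedIdeal.span (ofPath k '' S)

/-- The quotient algebra `kQ / I`. -/
abbrev QuotientAlgebra (I : TwoSidedIdeal (PathAlgebra k Q)) : Type (max u v w) :=
  I.ringCon.Quotient

/-- The set `F` of the minimal paths among the paths in `I`: the paths in `I` that have no proper
subpath in `I`. -/
def minimalPaths (I : TwoSidedIdeal (PathAlgebra k Q)) : Set (QPath Q) :=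
  {p | ofPath k p ∈ I ∧ ∀ q : QPath Q, q.IsSubpath p → q ≠ p → ofPath k q ∉ I}

/-- `p` is a nonzero path in `A = kQ / I`, i.e. `p` does not belong to `I`. -/
def IsNonzeroPath (I : TwoSidedIdeal (PathAlgebra k Q)) (p : QPath Q) : Prop :=
  ofPath k p ∉ I

/-- The pair `(p, q)` of nonzero paths in `A = kQ / I` is perfect. -/
structure IsPerfectPair (I : TwoSidedIdeal (PathAlgebra k Q)) (p q : QPath Q) : Prop where
  nonzero_left : IsNonzeroPath I p
  nonzero_right : IsNonzeroPath I q
  nontrivial_left : p.length ≠ 0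
  nontrivial_right : q.length ≠ 0
  /-- `s(p) = t(q)` and `pq = 0` in `A`. -/
  concat_eq_zero : ∃ h : q.tgt = p.src, ofPath k (p.concat q h) ∈ I
  /-- If `pq' = 0` for a nonzero path `q'` with `t(q') = s(p)`, then `q' = q q''`. -/
  right_factor : ∀ (q' : QPath Q) (h : q'.tgt = p.src), IsNonzeroPath I q' →
    ofPath k (p.concat q' h) ∈ I → ∃ (q'' : QPath Q) (h' : q''.tgt = q.src), q' = q.concat q'' h'
  /-- If `p'q = 0` for a nonzero path `p'` with `s(p') = t(q)`, then `p' = p'' p`. -/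
  left_factor : ∀ (p' : QPath Q) (h : q.tgt = p'.src), IsNonzeroPath I p' →
    ofPath k (p'.concat q h) ∈ I → ∃ (p'' : QPath Q) (h' : p.tgt = p''.src), p' = p''.concat p h'

/-- `p` is a perfect path in `A = kQ / I`: there is a sequence `p = p₀, p₁, …, pₙ = p` with `n ≥ 1`
of nonzero paths such that `(pᵢ, pᵢ₊₁)` is a perfect pair for all `0 ≤ i < n`. -/
def IsPerfectPath (I : TwoSidedIdeal (PathAlgebra k Q)) (p : QPath Q) : Prop :=
  ∃ (n : ℕ) (s : ℕ → QPath Q), 1 ≤ n ∧ s 0 = p ∧ s n = p ∧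
    ∀ i < n, IsPerfectPair I (s i) (s (i + 1))

end Monomial

/-- The ring `A` is `d`-Gorenstein: the injective dimensions of `A` as a left `A`-module and as a
right `A`-module (that is, as a left module over the opposite ring) are both at most `d`. -/
def IsDGorenstein (d : ℕ) (A : Type w) [Ring A] : Prop :=
  CategoryTheory.HasInjectiveDimensionLE (ModuleCat.of A A) d ∧
    CategoryTheory.HasInjectiveDimensionLE (ModuleCat.of Aᵐᵒᵖ A) d

end BoundQuiver

/-!
Write `A = kQ / I`. The nonzero paths form a `k`-basis of `A` in which a product of two basis
elements is zero or a basis element, and a nonzero product determines its factors once their lengths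
are known. Everything of a homological nature uses only this structure, `PathBasis`, which passes to
the opposite algebra, so that left modules suffice.

*Injective dimension and annihilators.* Embed `A` into an injective module `E`; then `A` has
injective dimension at most one exactly if `E / A` is injective (`hasInjectiveDimensionLE_one_iff`).
In that case every homomorphism from a left annihilator `{x | xq = 0}` to `A` is a right
multiplication (`exists_eq_mul_of_hasInjectiveDimensionLE_one`), which is the vanishing of
`Ext¹(Aq, A)`. Conversely, since the radical of `A` is nilpotent and is the direct sum of the left
ideals `Aa`, for `a` an arrow, it suffices to have this vanishing for the arrows
(`PathBasis.hasInjectiveDimensionLE_one`).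

*Gorenstein implies perfect.* Let `pq` be a minimal path in `I`. A path annihilating `q` from the
left without having `p` as a right factor would allow the homomorphism which is the identity on
`Ap` and zero on the other paths in the annihilator, and this is not a right multiplication; so
`Ap` is the left annihilator of `q`. If `p` had trivial left annihilator, then `p ↦ e` would be a
homomorphism on `Ap`, again not a right multiplication; so there is a minimal left annihilator
`p₀` of `p`. If `p₀q' = 0`, then `p ↦ q'` defines a homomorphism on `Ap`, so `q'` is a right
multiple of `p`. Hence `(p₀, p)` is a perfect pair, and the argument applies to `(p₀, p)` in place
of `(p, q)`. The operation `p ↦ p₀` is injective on a finite set, hence periodic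
(`PathBasis.IsLeftMinimal.exists_cycle`). Only the injective dimension of the left module is used
here.

*Perfect implies Gorenstein.* If an arrow `a` is annihilated by a path from the left, then there are
perfect pairs `(p₁, a)` and `(p₀, p₁)`. The first one says that `Ap₁` is the left annihilator of `a`,
the second one that the elements annihilated by `p₀` from the left, which are the possible images of
`p₁` under a homomorphism `Ap₁ → A`, form `p₁A`. Hence `Ext¹(Aa, A) = 0`
(`PathBasis.exists_lift_of_arrow`). The dual argument applies on the other side, where the pairs are
found on the cycle through `a`, as `a` is itself perfect.
-/

/-! ### Injective dimension at most one -/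

namespace BoundQuiver

section InjectiveDimension

variable {R : Type u} [Ring R]

/-- A variant of Baer's criterion: it suffices to extend a map defined on a proper left ideal `L`
to one further element `x`. -/
theorem baer_of_forall_extend {C : Type v} [AddCommGroup C] [Module R C]
    (H : ∀ L : Submodule R R, L ≠ ⊤ → ∀ f : L →ₗ[R] C,
      ∃ x ∉ L, ∃ y : C, ∀ (a : R) (h : a • x ∈ L), f ⟨a • x, h⟩ = a • y) :
    Module.Baer R C := by
  intro L g
  have : Fact (Function.Injective L.subtype) := ⟨L.injective_subtype⟩
  set M := Module.Baer.extensionOfMax L.subtype g with hM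
  have htop : M.domain = ⊤ := by
    by_contra hne
    obtain ⟨x, hx, y, hy⟩ := H M.domain hne M.toFun
    have hz : ∀ c : R, c • x = 0 → c • y = 0 := by
      intro c hc
      have hmem : c • x ∈ M.domain := hc ▸ M.domain.zero_mem
      rw [← hy c hmem]
      have : (⟨c • x, hmem⟩ : M.domain) = 0 := Subtype.ext hc
      rw [this, map_zero]
    let s : R →ₗ.[R] C := LinearPMap.mkSpanSingleton' x y hz
    have hagree : ∀ (a : M.domain) (b : s.domain), (a : R) = b → M.toLinearPMap a = s b := by
      rintro ⟨a, ha⟩ ⟨b, hb⟩ (rfl : a = b)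
      obtain ⟨c, rfl⟩ := Submodule.mem_span_singleton.1 hb
      exact (hy c ha).trans (LinearPMap.mkSpanSingleton'_apply x y hz c hb).symm
    let M' : Module.Baer.ExtensionOf L.subtype g :=
      { M.toLinearPMap.sup s hagree with
        le := M.le.trans (LinearPMap.left_le_sup _ _ hagree).1
        is_extension := fun m => (M.is_extension m).trans
          ((LinearPMap.left_le_sup _ _ hagree).2 rfl) }
    have hle : M ≤ M' := LinearPMap.left_le_sup _ _ hagree
    have heq := Module.Baer.extensionOfMax_is_max L.subtype g M' hle
    have hmem : x ∈ M'.domain :=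
      (LinearPMap.right_le_sup _ _ hagree).1 (Submodule.mem_span_singleton_self x)
    rw [heq] at hmem
    exact hx hmem
  refine ⟨M.toFun ∘ₗ (LinearEquiv.ofTop M.domain htop).symm.toLinearMap, fun x hx => ?_⟩
  exact (M.is_extension ⟨x, hx⟩).symm

/-- In an injective module `E` a system of equations `aᵢ • y = εᵢ` is solvable as soon as every
linear relation between the `aᵢ` also holds between the `εᵢ`. -/
theorem exists_smul_eq_of_injective {E : Type u} [AddCommGroup E] [Module R E]
    [Module.Injective R E] {ι : Type v} (a : ι → R) (ε : ι → E)
    (h : ∀ r : ι →₀ R, (r.sum fun i c => c * a i) = 0 → (r.sum fun i c => c • ε i) = 0) :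
    ∃ y : E, ∀ i, a i • y = ε i := by
  have hker : LinearMap.ker (Finsupp.linearCombination R a) ≤
      LinearMap.ker (Finsupp.linearCombination R ε) := by
    intro r hr
    rw [LinearMap.mem_ker, Finsupp.linearCombination_apply] at hr ⊢
    exact h r hr
  let g : LinearMap.range (Finsupp.linearCombination R a) →ₗ[R] E :=
    (Submodule.liftQ _ _ hker) ∘ₗ
      (LinearMap.quotKerEquivRange (Finsupp.linearCombination R a)).symm.toLinearMap
  have hg : ∀ r, g ⟨Finsupp.linearCombination R a r, r, rfl⟩ = Finsupp.linearCombination R ε r := by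
    intro r
    have : (⟨Finsupp.linearCombination R a r, r, rfl⟩ :
        LinearMap.range (Finsupp.linearCombination R a)) =
        LinearMap.quotKerEquivRange _ (Submodule.Quotient.mk r) := rfl
    rw [this]
    simp [g]
  obtain ⟨g', hg'⟩ := Module.Baer.of_injective ‹Module.Injective R E› _ g
  refine ⟨g' 1, fun i => ?_⟩
  have hmem : a i ∈ LinearMap.range (Finsupp.linearCombination R a) :=
    ⟨Finsupp.single i 1, by simp⟩
  have h2 := hg (Finsupp.single i 1)
  have h3 : (⟨Finsupp.linearCombination R a (Finsupp.single i 1), Finsupp.single i 1, rfl⟩ :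
        LinearMap.range (Finsupp.linearCombination R a)) = ⟨a i, hmem⟩ :=
    Subtype.ext (by simp)
  rw [h3, ← hg' (a i) hmem] at h2
  rw [← map_smul, smul_eq_mul, mul_one, h2]
  simp

variable (R) in
/-- An injective embedding `R → E` of the regular module. -/
theorem exists_injective_embedding :
    ∃ (E : Type u) (_ : AddCommGroup E) (_ : Module R E) (ι : R →ₗ[R] E),
      Module.Injective R E ∧ Function.Injective ι := by
  obtain ⟨⟨J, _, f, _⟩⟩ := CategoryTheory.EnoughInjectives.presentation (ModuleCat.of R R)
  refine ⟨J, inferInstance, inferInstance, f.hom, ?_, (ModuleCat.mono_iff_injective f).1 ‹_›⟩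
  exact Module.injective_module_of_injective_object R J

/-- If `E` is injective, then `R ⊆ E` has injective dimension at most one if and only if `E / R` is
injective. -/
theorem hasInjectiveDimensionLE_one_iff {E : Type u} [AddCommGroup E] [Module R E]
    [Module.Injective R E] (ι : R →ₗ[R] E) (hι : Function.Injective ι) :
    CategoryTheory.HasInjectiveDimensionLE (ModuleCat.of R R) 1 ↔
      Module.Baer R (E ⧸ LinearMap.range ι) := by
  let S : CategoryTheory.ShortComplex (ModuleCat.{u} R) :=
    CategoryTheory.ShortComplex.mk (ModuleCat.ofHom ι)
      (ModuleCat.ofHom (LinearMap.range ι).mkQ) (by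
        ext
        simp)
  have hS : S.ShortExact :=
    { exact := by
        rw [CategoryTheory.ShortComplex.moduleCat_exact_iff]
        intro x hx
        exact (Submodule.Quotient.mk_eq_zero _).1 hx
      mono_f := (ModuleCat.mono_iff_injective _).2 hι
      epi_g := (ModuleCat.epi_iff_surjective _).2 (Submodule.mkQ_surjective _) }
  have hE : CategoryTheory.Injective S.X₂ := Module.injective_object_of_injective_module R E
  rw [Module.Baer.iff_injective, Module.injective_iff_injective_object,
    CategoryTheory.injective_iff_hasInjectiveDimensionLT_one]
  exact (hS.hasInjectiveDimensionLT_X₃_iff 0 hE).symm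

/-- If `R` has injective dimension at most one, then the extension group of `Rq` by `R` vanishes:
every map `{x | xq = 0} → R` is the right multiplication by an element of `R`. -/
theorem exists_eq_mul_of_hasInjectiveDimensionLE_one
    (h : CategoryTheory.HasInjectiveDimensionLE (ModuleCat.of R R) 1) (q : R)
    (φ : LinearMap.ker (LinearMap.toSpanSingleton R R q) →ₗ[R] R) :
    ∃ y : R, ∀ x, φ x = x * y := by
  obtain ⟨E, _, _, ι, hE, hι⟩ := exists_injective_embedding R
  have hC := (hasInjectiveDimensionLE_one_iff ι hι).1 h
  obtain ⟨ψ, hψ⟩ := Module.Baer.of_injective hE _ (ι ∘ₗ φ)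
  have hψ1 : ∀ c : R, ψ c = c • ψ 1 := fun c => by rw [← map_smul, smul_eq_mul, mul_one]
  -- the map `xq ↦ x • ψ 1` from `Rq` to `E / R` is well defined
  have hz : ∀ c : R, c • q = 0 → c • (LinearMap.range ι).mkQ (ψ 1) = 0 := by
    intro c hc
    rw [← map_smul, ← hψ1, hψ c hc]
    exact (Submodule.Quotient.mk_eq_zero _).2 ⟨_, rfl⟩
  let s : R →ₗ.[R] (E ⧸ LinearMap.range ι) :=
    LinearPMap.mkSpanSingleton' q ((LinearMap.range ι).mkQ (ψ 1)) hz
  obtain ⟨g, hg⟩ := hC s.domain s.toFun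
  obtain ⟨c, hc⟩ := Submodule.mkQ_surjective _ (g 1)
  have hq : q • g 1 = (LinearMap.range ι).mkQ (ψ 1) := by
    have hmem : (1 : R) • q ∈ s.domain := by
      rw [one_smul]
      exact Submodule.mem_span_singleton_self q
    have := (LinearPMap.mkSpanSingleton'_apply q ((LinearMap.range ι).mkQ (ψ 1)) hz 1 hmem).trans
      (one_smul R _)
    rw [← map_smul, smul_eq_mul, mul_one, hg q (Submodule.mem_span_singleton_self q), ← this]
    exact congrArg s.toFun (Subtype.ext (one_smul R q).symm)
  rw [← hc, ← map_smul, ← sub_eq_zero, ← map_sub] at hq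
  obtain ⟨y, hy⟩ := (Submodule.Quotient.mk_eq_zero _).1 hq
  refine ⟨-y, fun x => hι ?_⟩
  have hx : (x : R) * q = 0 := x.2
  have h1 : ι (φ x) = (x : R) • ψ 1 := by
    rw [← hψ1, hψ _ x.2]
    rfl
  rw [h1, ← smul_eq_mul (x : R), map_smul, map_neg, hy, neg_sub, smul_sub, ← mul_smul, hx,
    zero_smul, sub_zero]

end InjectiveDimension

end BoundQuiver

/-! ### Path bases -/

namespace BoundQuiver

/-- A `k`-basis of an algebra `R` which behaves like the basis of nonzero paths of a monomial
algebra: the product of two basis elements is zero or a basis element, and a nonzero product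
determines its factors once their lengths are known; every path splits at every length. The set `P`
indexes the basis, `V` is the set of vertices, and `triv v` is the path of length zero at `v`. The
axioms are symmetric under reversing the multiplication, see `PathBasis.op`. -/
structure PathBasis (k : Type*) (R : Type*) (V : Type*) (P : Type*) [Field k] [Ring R]
    [Algebra k R] [Fintype V] where
  b : Module.Basis P k R
  src : P → V
  tgt : P → V
  len : P → ℕ
  triv : V → P
  mul_eq_zero_or : ∀ p q, b p * b q = 0 ∨
    ∃ r, b p * b q = b r ∧ src r = src q ∧ tgt r = tgt p ∧ len r = len p + len q
  src_eq_tgt : ∀ p q, b p * b q ≠ 0 → src p = tgt q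
  mul_triv : ∀ p, b p * b (triv (src p)) = b p
  triv_mul : ∀ p, b (triv (tgt p)) * b p = b p
  src_triv : ∀ v, src (triv v) = v
  tgt_triv : ∀ v, tgt (triv v) = v
  len_triv : ∀ v, len (triv v) = 0
  eq_triv : ∀ p, len p = 0 → p = triv (src p)
  unique : ∀ p q p' q', b p * b q = b p' * b q' → b p * b q ≠ 0 → len q = len q' →
    p = p' ∧ q = q'
  exists_split : ∀ p n, n ≤ len p → ∃ p' p'', b p = b p' * b p'' ∧ len p'' = n
  bounded : ∃ m, ∀ p, len p < m
  sum_triv : ∑ v, b (triv v) = 1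

namespace PathBasis

variable {k : Type*} {R : Type*} {V : Type*} {P : Type*} [Field k] [Ring R]
    [Algebra k R] [Fintype V] (D : PathBasis k R V P)

section Basic

theorem ne_zero (p : P) : D.b p ≠ 0 := D.b.ne_zero p

theorem inj {p q : P} (h : D.b p = D.b q) : p = q := D.b.injective h

theorem of_eq_mul {p q r : P} (h : D.b r = D.b p * D.b q) :
    src D p = tgt D q ∧ D.src r = D.src q ∧ D.tgt r = D.tgt p ∧ D.len r = D.len p + D.len q := by
  have hne : D.b p * D.b q ≠ 0 := h ▸ D.ne_zero r
  refine ⟨D.src_eq_tgt p q hne, ?_⟩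
  obtain h0 | ⟨r', hr', hs⟩ := D.mul_eq_zero_or p q
  · exact absurd h0 hne
  · rw [D.inj (h.trans hr')]
    exact hs

theorem tgt_eq_src_of_len_eq_zero {p : P} (h : D.len p = 0) : D.tgt p = D.src p := by
  rw [D.eq_triv p h, D.tgt_triv, D.src_triv]

theorem eq_of_len_eq_zero_right {p q r : P} (h : D.b r = D.b p * D.b q) (hq : D.len q = 0) :
    r = p := by
  have h1 := (D.of_eq_mul h).1
  rw [D.eq_triv q hq, ← D.tgt_eq_src_of_len_eq_zero hq, ← h1, D.mul_triv] at h
  exact D.inj h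

theorem unique_left {p q p' : P} (h : D.b p * D.b q = D.b p' * D.b q) (h0 : D.b p * D.b q ≠ 0) :
    p = p' :=
  (D.unique p q p' q h h0 rfl).1

theorem unique_of_len_left {p q p' q' : P} (h : D.b p * D.b q = D.b p' * D.b q')
    (h0 : D.b p * D.b q ≠ 0) (hl : D.len p = D.len p') : p = p' ∧ q = q' := by
  obtain h1 | ⟨r, hr, hs⟩ := D.mul_eq_zero_or p q
  · exact absurd h1 h0
  · have h2 := D.of_eq_mul (h.symm.trans hr).symm
    exact D.unique p q p' q' h h0 (by omega)

/-- The path basis of the opposite algebra. -/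
noncomputable def op : PathBasis k Rᵐᵒᵖ V P where
  b := D.b.map (MulOpposite.opLinearEquiv k)
  src := D.tgt
  tgt := D.src
  len := D.len
  triv := D.triv
  mul_eq_zero_or p q := by
    obtain h | ⟨r, hr, h1, h2, h3⟩ := D.mul_eq_zero_or q p
    · left
      simp [← MulOpposite.op_mul, h]
    · refine Or.inr ⟨r, ?_, h2, h1, by omega⟩
      simp [← MulOpposite.op_mul, hr]
  src_eq_tgt p q h := by
    refine (D.src_eq_tgt q p fun h0 => h ?_).symm
    simp [← MulOpposite.op_mul, h0]
  mul_triv p := by simp [← MulOpposite.op_mul, D.triv_mul]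
  triv_mul p := by simp [← MulOpposite.op_mul, D.mul_triv]
  src_triv := D.tgt_triv
  tgt_triv := D.src_triv
  len_triv := D.len_triv
  eq_triv p h := by rw [D.tgt_eq_src_of_len_eq_zero h]; exact D.eq_triv p h
  unique p q p' q' h h0 hl := by
    simp only [Module.Basis.map_apply, MulOpposite.coe_opLinearEquiv, ← MulOpposite.op_mul,
      MulOpposite.op_inj, ne_eq, MulOpposite.op_eq_zero_iff] at h h0
    exact (D.unique_of_len_left h h0 hl).symm
  exists_split p n hn := by
    obtain ⟨p', p'', h, hl⟩ := D.exists_split p (D.len p - n) (Nat.sub_le _ _)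
    refine ⟨p'', p', by simp [← MulOpposite.op_mul, h], ?_⟩
    have := (D.of_eq_mul h).2.2.2
    omega
  bounded := D.bounded
  sum_triv := by
    simp only [Module.Basis.map_apply]
    rw [← map_sum, D.sum_triv]
    rfl

theorem op_b (p : P) : D.op.b p = MulOpposite.op (D.b p) := by
  simp [op]

/-- If `st = rp` is nonzero and `t` is at least as long as `p`, then `p` is a right
factor of `t`. -/
theorem exists_eq_mul_of_le {r s t p : P} (h : D.b s * D.b t = D.b r * D.b p)
    (h0 : D.b s * D.b t ≠ 0) (hl : D.len p ≤ D.len t) : ∃ t', D.b t = D.b t' * D.b p := by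
  obtain ⟨t', t'', ht, hlt⟩ := D.exists_split t _ hl
  refine ⟨t', ?_⟩
  rw [ht, ← mul_assoc] at h h0
  obtain h1 | ⟨u, hu, -⟩ := D.mul_eq_zero_or s t'
  · rw [h1, zero_mul] at h0
    exact absurd rfl h0
  · rw [hu] at h h0
    rw [ht, (D.unique _ _ _ _ h h0 hlt).2]

/-- If the product of `x` with a path is zero, then so are the products of all paths in the
support of `x`: the path basis is multiplicatively cancellative. -/
theorem mul_eq_zero_of_repr_ne_zero {x : R} {q p : P} (h : x * D.b q = 0)
    (hp : D.b.repr x p ≠ 0) : D.b p * D.b q = 0 := by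
  by_contra h0
  obtain h1 | ⟨r, hr, -⟩ := D.mul_eq_zero_or p q
  · exact h0 h1
  -- the coefficient of `pq` in `xq` is the coefficient of `p` in `x`
  have key : ∀ z : R, D.b.repr (z * D.b q) r = D.b.repr z p := by
    intro z
    have : (Finsupp.lapply r ∘ₗ D.b.repr.toLinearMap) ∘ₗ LinearMap.mulRight k (D.b q) =
        Finsupp.lapply p ∘ₗ D.b.repr.toLinearMap := by
      refine D.b.ext fun s => ?_
      simp only [LinearMap.comp_apply, LinearMap.mulRight_apply, Finsupp.lapply_apply,
        LinearEquiv.coe_coe, Module.Basis.repr_self]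
      by_cases hs : s = p
      · rw [hs, hr, Module.Basis.repr_self, Finsupp.single_eq_same, Finsupp.single_eq_same]
      · rw [Finsupp.single_eq_of_ne (Ne.symm hs)]
        obtain h2 | ⟨u, hu, -⟩ := D.mul_eq_zero_or s q
        · rw [h2, map_zero, Finsupp.zero_apply]
        · rw [hu, Module.Basis.repr_self, Finsupp.single_eq_of_ne]
          rintro rfl
          exact hs (D.unique_left (hr.trans hu.symm) h0).symm
    exact LinearMap.congr_fun this z
  rw [← key x, h, map_zero] at hp
  exact hp rfl

theorem mul_eq_zero_of_repr_ne_zero' {x : R} {q p : P} (h : D.b q * x = 0)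
    (hp : D.b.repr x p ≠ 0) : D.b q * D.b p = 0 := by
  have := D.op.mul_eq_zero_of_repr_ne_zero (x := MulOpposite.op x) (q := q) (p := p)
    (by rw [op_b, ← MulOpposite.op_mul, h, MulOpposite.op_zero]) (by simpa [op] using hp)
  rwa [op_b, op_b, ← MulOpposite.op_mul, MulOpposite.op_eq_zero_iff] at this

theorem mem_of_repr {W : Submodule k R} {x : R} (h : ∀ p, D.b.repr x p ≠ 0 → D.b p ∈ W) :
    x ∈ W := by
  rw [← D.b.linearCombination_repr x, Finsupp.linearCombination_apply]
  exact W.sum_mem fun p hp => W.smul_mem _ (h p (Finsupp.mem_support_iff.1 hp))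

/-- The paths occurring in a left multiple `xq` are of the form `rq`. -/
theorem exists_eq_mul_of_repr_mul_ne_zero {x : R} {q p : P} (h : D.b.repr (x * D.b q) p ≠ 0) :
    ∃ r, D.b p = D.b r * D.b q := by
  have hspan : x * D.b q ∈ Submodule.span k (D.b '' {s | ∃ r, D.b s = D.b r * D.b q}) := by
    have : x ∈ (Submodule.span k (D.b '' {s | ∃ r, D.b s = D.b r * D.b q})).comap
        (LinearMap.mulRight k (D.b q)) := by
      refine D.mem_of_repr fun r _ => ?_
      rw [Submodule.mem_comap, LinearMap.mulRight_apply]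
      obtain h0 | ⟨s, hs, -⟩ := D.mul_eq_zero_or r q
      · rw [h0]
        exact Submodule.zero_mem _
      · rw [hs]
        exact Submodule.subset_span ⟨s, ⟨r, hs.symm⟩, rfl⟩
    exact this
  rw [D.b.mem_span_image] at hspan
  exact hspan (Finsupp.mem_support_iff.2 h)

theorem exists_eq_mul_of_repr_mul_ne_zero' {x : R} {q p : P} (h : D.b.repr (D.b q * x) p ≠ 0) :
    ∃ r, D.b p = D.b q * D.b r := by
  obtain ⟨r, hr⟩ := D.op.exists_eq_mul_of_repr_mul_ne_zero (x := MulOpposite.op x) (q := q) (p := p)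
    (by rw [op_b, ← MulOpposite.op_mul]; simpa [op] using h)
  rw [op_b, op_b, op_b, ← MulOpposite.op_mul, MulOpposite.op_inj] at hr
  exact ⟨r, hr⟩

theorem repr_mul_triv {x : R} {v : V} {p : P} (h : D.b.repr (x * D.b (D.triv v)) p ≠ 0) :
    D.src p = v := by
  have : x * D.b (D.triv v) ∈ Submodule.span k (D.b '' {p | D.src p = v}) := by
    have hx : x ∈ (Submodule.span k (D.b '' {p | D.src p = v})).comap
        (LinearMap.mulRight k (D.b (D.triv v))) := by
      refine D.mem_of_repr fun s _ => ?_
      rw [Submodule.mem_comap, LinearMap.mulRight_apply]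
      obtain h0 | ⟨r, hr, h1, -⟩ := D.mul_eq_zero_or s (D.triv v)
      · rw [h0]
        exact Submodule.zero_mem _
      · rw [hr]
        exact Submodule.subset_span ⟨r, h1.trans (D.src_triv v), rfl⟩
    exact hx
  rw [D.b.mem_span_image] at this
  exact this (Finsupp.mem_support_iff.2 h)

theorem mul_triv_eq_zero_of_ne {p : P} {v : V} (h : D.src p ≠ v) :
    D.b p * D.b (D.triv v) = 0 := by
  by_contra h0
  exact h ((D.src_eq_tgt _ _ h0).trans (D.tgt_triv v))

end Basic

section Filtration

/-- The span of the paths of length at least `n`. -/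
def radPow (n : ℕ) : Submodule k R := Submodule.span k (D.b '' {p | n ≤ D.len p})

theorem mem_radPow_iff {n : ℕ} {x : R} :
    x ∈ D.radPow n ↔ ∀ p, D.b.repr x p ≠ 0 → n ≤ D.len p := by
  rw [radPow, D.b.mem_span_image]
  exact ⟨fun h p hp => h (Finsupp.mem_support_iff.2 hp),
    fun h p hp => h p (Finsupp.mem_support_iff.1 hp)⟩

theorem mem_radPow_zero (x : R) : x ∈ D.radPow 0 := D.mem_radPow_iff.2 fun _ _ => Nat.zero_le _

theorem basis_mem_radPow {n : ℕ} {p : P} (h : n ≤ D.len p) : D.b p ∈ D.radPow n :=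
  Submodule.subset_span ⟨p, h, rfl⟩

theorem mul_mem_radPow {m n : ℕ} {x y : R} (hx : x ∈ D.radPow m) (hy : y ∈ D.radPow n) :
    x * y ∈ D.radPow (m + n) := by
  have h : D.radPow m * D.radPow n ≤ D.radPow (m + n) := by
    rw [radPow, radPow, Submodule.span_mul_span, Submodule.span_le]
    rintro _ ⟨_, ⟨p, hp, rfl⟩, _, ⟨q, hq, rfl⟩, rfl⟩
    obtain h0 | ⟨r, hr, -, -, hl⟩ := D.mul_eq_zero_or p q
    · simp only [h0]
      exact Submodule.zero_mem _
    · simp only [hr]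
      refine D.basis_mem_radPow ?_
      simp only [Set.mem_ofPred_eq] at hp hq
      omega
  exact h (Submodule.mul_mem_mul hx hy)

theorem exists_radPow_eq_zero : ∃ m, ∀ x ∈ D.radPow m, x = 0 := by
  obtain ⟨m, hm⟩ := D.bounded
  refine ⟨m, fun x hx => ?_⟩
  rw [mem_radPow_iff] at hx
  refine D.b.repr.map_eq_zero_iff.1 (Finsupp.ext fun p => ?_)
  by_contra h
  exact absurd (hx p h) (not_le.2 (hm p))

end Filtration

end PathBasis

end BoundQuiver

/-! ### Injective dimension at most one forces cycles of perfect pairs -/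

namespace BoundQuiver

namespace PathBasis

/-- The pair `(p, q)` is perfect, in terms of a path basis. -/
structure IsPerfectPair {k : Type*} {R : Type*} {V : Type*} {P : Type*} [Field k] [Ring R]
    [Algebra k R] [Fintype V] (D : PathBasis k R V P) (p q : P) : Prop where
  len_left : D.len p ≠ 0
  len_right : D.len q ≠ 0
  src_eq_tgt : D.src p = D.tgt q
  mul_eq_zero : D.b p * D.b q = 0
  right_factor : ∀ q', D.tgt q' = D.src p → D.b p * D.b q' = 0 → ∃ r, D.b q' = D.b q * D.b r
  left_factor : ∀ p', D.src p' = D.tgt q → D.b p' * D.b q = 0 → ∃ r, D.b p' = D.b r * D.b p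

/-- The path `p` annihilates `q` from the left and is minimal with this property: no proper right
factor of `p` does. -/
structure IsLeftMinimal {k : Type*} {R : Type*} {V : Type*} {P : Type*} [Field k] [Ring R]
    [Algebra k R] [Fintype V] (D : PathBasis k R V P) (p q : P) : Prop where
  src_eq_tgt : D.src p = D.tgt q
  mul_eq_zero : D.b p * D.b q = 0
  minimal : ∀ r t, D.b p = D.b r * D.b t → D.b t * D.b q = 0 → D.len r = 0

section Combinatorics

variable {k : Type*} {R : Type*} {V : Type*} {P : Type*} [Field k] [Ring R]
    [Algebra k R] [Fintype V] (D : PathBasis k R V P)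

variable {D}

theorem IsLeftMinimal.len_ne_zero {p q : P} (h : D.IsLeftMinimal p q) : D.len p ≠ 0 := by
  intro h0
  have h1 := h.mul_eq_zero
  rw [D.eq_triv p h0, h.src_eq_tgt, D.triv_mul] at h1
  exact D.ne_zero q h1

/-- If some path annihilates `p` from the left, then a shortest one is minimal. -/
theorem exists_isLeftMinimal {r p : P} (h1 : D.src r = D.tgt p) (h2 : D.b r * D.b p = 0) :
    ∃ p₀, D.IsLeftMinimal p₀ p := by
  obtain ⟨p₀, ⟨h3, h4⟩, hmin⟩ := exists_minimalFor_of_wellFoundedLT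
    (fun r => D.src r = D.tgt p ∧ D.b r * D.b p = 0) D.len ⟨r, h1, h2⟩
  refine ⟨p₀, h3, h4, fun u t hut ht => ?_⟩
  obtain ⟨-, hs, -, hl⟩ := D.of_eq_mul hut
  have := hmin (j := t) ⟨hs.symm.trans h3, ht⟩ (by omega)
  omega

theorem IsPerfectPair.right_unique {p q q' : P} (h : D.IsPerfectPair p q)
    (h' : D.IsPerfectPair p q') : q = q' := by
  obtain ⟨r, hr⟩ := h.right_factor q' h'.src_eq_tgt.symm h'.mul_eq_zero
  obtain ⟨s, hs⟩ := h'.right_factor q h.src_eq_tgt.symm h.mul_eq_zero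
  have h1 := (D.of_eq_mul hr).2.2.2
  have h2 := (D.of_eq_mul hs).2.2.2
  exact (D.eq_of_len_eq_zero_right hr (by omega)).symm

end Combinatorics

section Forward

variable {k : Type*} {R : Type u} {V : Type*} {P : Type*} [Field k] [Ring R]
    [Algebra k R] [Fintype V] {D : PathBasis k R V P}

/-- For a minimal left annihilator `p` of `q`, the assignment `rp ↦ rq'`, extended by zero to the
other paths annihilating `q`, is a module homomorphism `{x | xq = 0} → R`; when `R` has injective
dimension at most one it is the right multiplication by some `y`. -/
theorem IsLeftMinimal.exists_mul_eq
    (hR : CategoryTheory.HasInjectiveDimensionLE (ModuleCat.of R R) 1) {p q q' : P}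
    (hp : D.IsLeftMinimal p q) (ht : D.tgt q' = D.tgt p)
    (hq' : ∀ r, D.b r * D.b p = 0 → D.b r * D.b q' = 0) :
    ∃ y : R, D.b p * y = D.b q' ∧
      ∀ p', D.b p' * D.b q = 0 → (¬ ∃ r, D.b p' = D.b r * D.b p) → D.b p' * y = 0 := by
  classical
  let Φ : R →ₗ[k] R := D.b.constr k fun s =>
    if h : ∃ r, D.b s = D.b r * D.b p then D.b h.choose * D.b q' else 0
  have hΦ1 : ∀ r, Φ (D.b r * D.b p) = D.b r * D.b q' := by
    intro r
    obtain h0 | ⟨s, hs, -⟩ := D.mul_eq_zero_or r p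
    · rw [h0, hq' r h0, map_zero]
    · have h : ∃ r, D.b s = D.b r * D.b p := ⟨r, hs.symm⟩
      have hr : h.choose = r := D.unique_left (h.choose_spec.symm.trans hs.symm)
        (h.choose_spec ▸ D.ne_zero s)
      rw [hs, Module.Basis.constr_basis, dif_pos h, hr]
  have hΦ0 : ∀ s, (¬ ∃ r, D.b s = D.b r * D.b p) → Φ (D.b s) = 0 := by
    intro s hs
    rw [Module.Basis.constr_basis, dif_neg hs]
  have hmul : ∀ s t, D.b t * D.b q = 0 → Φ (D.b s * D.b t) = D.b s * Φ (D.b t) := by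
    intro s t htq
    by_cases h : ∃ r, D.b t = D.b r * D.b p
    · obtain ⟨r, hr⟩ := h
      rw [hr, hΦ1, ← mul_assoc, ← mul_assoc]
      obtain h0 | ⟨u, hu, -⟩ := D.mul_eq_zero_or s r
      · rw [h0, zero_mul, zero_mul, map_zero]
      · rw [hu, hΦ1]
    · rw [hΦ0 t h, mul_zero]
      obtain h0 | ⟨u, hu, -⟩ := D.mul_eq_zero_or s t
      · rw [h0, map_zero]
      · rw [hu]
        refine hΦ0 u ?_
        rintro ⟨r, hr⟩
        have hst : D.b s * D.b t = D.b r * D.b p := hu.trans hr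
        have hst0 : D.b s * D.b t ≠ 0 := hu ▸ D.ne_zero u
        obtain hl | hl := le_or_gt (D.len p) (D.len t)
        · exact h (D.exists_eq_mul_of_le hst hst0 hl)
        -- otherwise `t` is a proper right factor of `p`, against minimality
        · obtain ⟨t', ht'⟩ := D.exists_eq_mul_of_le hst.symm (hst ▸ hst0) hl.le
          have h1 := hp.minimal t' t ht' htq
          have h2 := (D.of_eq_mul ht').2.2.2
          omega
  have hlin : ∀ a x : R, x * D.b q = 0 → Φ (a * x) = a * Φ x := by
    intro a x hx
    have hx' : x ∈ Submodule.span k (D.b '' {t | D.b t * D.b q = 0}) :=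
      D.mem_of_repr fun t h => Submodule.subset_span ⟨t, D.mul_eq_zero_of_repr_ne_zero hx h, rfl⟩
    refine LinearMap.eqOn_span (f := Φ ∘ₗ LinearMap.mulLeft k a)
      (g := LinearMap.mulLeft k a ∘ₗ Φ) ?_ hx'
    rintro _ ⟨t, ht, rfl⟩
    have : Φ ∘ₗ LinearMap.mulRight k (D.b t) = LinearMap.mulRight k (Φ (D.b t)) :=
      D.b.ext fun s => hmul s t ht
    exact LinearMap.congr_fun this a
  let φ : LinearMap.ker (LinearMap.toSpanSingleton R R (D.b q)) →ₗ[R] R :=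
    { toFun := fun x => Φ x
      map_add' := fun x y => by simp
      map_smul' := fun a x => hlin a x x.2 }
  obtain ⟨y, hy⟩ := exists_eq_mul_of_hasInjectiveDimensionLE_one hR (D.b q) φ
  refine ⟨y, ?_, fun p' h1 h2 => ?_⟩
  · have h3 : Φ (D.b p) = D.b p * y := hy ⟨D.b p, hp.mul_eq_zero⟩
    rw [← h3]
    have h4 := hΦ1 (D.triv (D.tgt p))
    rwa [D.triv_mul, ← ht, D.triv_mul] at h4
  · have h3 : Φ (D.b p') = D.b p' * y := hy ⟨D.b p', h1⟩
    rw [← h3, hΦ0 p' h2]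

/-- A minimal left annihilator of `q` generates the left annihilator of `q`. -/
theorem IsLeftMinimal.left_factor
    (hR : CategoryTheory.HasInjectiveDimensionLE (ModuleCat.of R R) 1) {p q : P}
    (hp : D.IsLeftMinimal p q) {p' : P} (h1 : D.src p' = D.tgt q) (h2 : D.b p' * D.b q = 0) :
    ∃ r, D.b p' = D.b r * D.b p := by
  by_contra h
  obtain ⟨y, hy1, hy2⟩ := hp.exists_mul_eq hR (q' := p) rfl fun _ => id
  -- the equation `p'y = 0` forces the coefficient of the trivial path in `y` to be zero, while
  -- `py = p` forces it to be one
  have h3 : D.b.repr y (D.triv (D.src p)) = 0 := by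
    by_contra h3
    have := D.mul_eq_zero_of_repr_ne_zero' (hy2 p' h2 h) h3
    rw [hp.src_eq_tgt, ← h1, D.mul_triv] at this
    exact D.ne_zero p' this
  have h4 : D.b p * (y - D.b (D.triv (D.src p))) = 0 := by
    rw [mul_sub, hy1, D.mul_triv, sub_self]
  have h5 : D.b.repr (y - D.b (D.triv (D.src p))) (D.triv (D.src p)) ≠ 0 := by
    simp [h3]
  have := D.mul_eq_zero_of_repr_ne_zero' h4 h5
  rw [D.mul_triv] at this
  exact D.ne_zero p this

/-- A minimal left annihilator `p` has itself a left annihilator, since otherwise `Rp` would be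
projective and `p ↦ 1` would not be a right multiplication. -/
theorem IsLeftMinimal.exists_left
    (hR : CategoryTheory.HasInjectiveDimensionLE (ModuleCat.of R R) 1) {p q : P}
    (hp : D.IsLeftMinimal p q) : ∃ r, D.src r = D.tgt p ∧ D.b r * D.b p = 0 := by
  by_contra! h
  obtain ⟨y, hy, -⟩ := hp.exists_mul_eq hR (q' := D.triv (D.tgt p)) (D.tgt_triv _) fun r hr =>
    D.mul_triv_eq_zero_of_ne fun h1 => h r h1 hr
  have h1 : D.b p * y ∈ D.radPow (1 + 0) :=
    D.mul_mem_radPow (D.basis_mem_radPow (Nat.one_le_iff_ne_zero.2 hp.len_ne_zero))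
      (D.mem_radPow_zero y)
  rw [hy, mem_radPow_iff] at h1
  have := h1 (D.triv (D.tgt p)) (by simp)
  rw [D.len_triv] at this
  omega

/-- The right annihilator of a minimal left annihilator `p₀` of `p` is generated by `p`: if
`p₀q' = 0` then `rp ↦ rq'` is well defined, hence is the right multiplication by some `y` with
`py = q'`. -/
theorem IsLeftMinimal.right_factor
    (hR : CategoryTheory.HasInjectiveDimensionLE (ModuleCat.of R R) 1) {p₀ p q : P}
    (hp : D.IsLeftMinimal p q) (hp₀ : D.IsLeftMinimal p₀ p) {q' : P}
    (h1 : D.tgt q' = D.src p₀) (h2 : D.b p₀ * D.b q' = 0) :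
    ∃ r, D.b q' = D.b p * D.b r := by
  obtain ⟨y, hy, -⟩ := hp.exists_mul_eq hR (q' := q') (h1.trans hp₀.src_eq_tgt) (by
    intro r hr
    by_cases hs : D.src r = D.tgt p
    · obtain ⟨u, hu⟩ := hp₀.left_factor hR hs hr
      rw [hu, mul_assoc, h2, mul_zero]
    · by_contra h0
      exact hs ((D.src_eq_tgt _ _ h0).trans (h1.trans hp₀.src_eq_tgt)))
  exact D.exists_eq_mul_of_repr_mul_ne_zero' (x := y) (by simp [hy])

theorem IsLeftMinimal.isPerfectPair
    (hR : CategoryTheory.HasInjectiveDimensionLE (ModuleCat.of R R) 1) {p₀ p q : P}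
    (hp : D.IsLeftMinimal p q) (hp₀ : D.IsLeftMinimal p₀ p) : D.IsPerfectPair p₀ p where
  len_left := hp₀.len_ne_zero
  len_right := hp.len_ne_zero
  src_eq_tgt := hp₀.src_eq_tgt
  mul_eq_zero := hp₀.mul_eq_zero
  right_factor _ h1 h2 := hp.right_factor hR hp₀ h1 h2
  left_factor _ h1 h2 := hp₀.left_factor hR h1 h2

/-- Passing from a minimal left annihilator to its own minimal left annihilator is an injective
operation on a finite set, hence every minimal left annihilator lies on a cycle. -/
theorem IsLeftMinimal.exists_cycle [Finite P]
    (hR : CategoryTheory.HasInjectiveDimensionLE (ModuleCat.of R R) 1) {p q : P}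
    (hp : D.IsLeftMinimal p q) :
    ∃ (n : ℕ) (s : ℕ → P), 1 ≤ n ∧ s 0 = p ∧ s n = p ∧
      ∀ i < n, D.IsPerfectPair (s i) (s (i + 1)) := by
  have hnext : ∀ t : {p : P // ∃ q, D.IsLeftMinimal p q}, ∃ p₀, D.IsLeftMinimal p₀ t.1 := by
    rintro ⟨t, q, ht⟩
    obtain ⟨r, hr1, hr2⟩ := ht.exists_left hR
    exact exists_isLeftMinimal hr1 hr2
  choose g hg using hnext
  let f : {p : P // ∃ q, D.IsLeftMinimal p q} → {p : P // ∃ q, D.IsLeftMinimal p q} :=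
    fun t => ⟨g t, t.1, hg t⟩
  have hpair : ∀ t, D.IsPerfectPair (f t).1 t.1 := fun t =>
    t.2.choose_spec.isPerfectPair hR (hg t)
  have hf : Function.Injective f := fun a b hab =>
    Subtype.ext ((hpair a).right_unique (hab ▸ hpair b))
  obtain ⟨n, hn, hper⟩ := hf.mem_periodicPts ⟨p, q, hp⟩
  refine ⟨n, fun i => (f^[n - i] ⟨p, q, hp⟩).1, hn, ?_, ?_, fun i hi => ?_⟩
  · exact congrArg Subtype.val hper
  · simp
  · have : n - i = (n - (i + 1)) + 1 := by omega
    simp only [this, Function.iterate_succ_apply']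
    exact hpair _

end Forward

end PathBasis

end BoundQuiver

/-! ### Perfect pairs at the arrows force injective dimension at most one -/

namespace BoundQuiver

namespace PathBasis

section Backward

variable {k : Type*} {R : Type*} {V : Type*} {P : Type*} [Field k] [Ring R]
    [Algebra k R] [Fintype V] {D : PathBasis k R V P}

/-- The left annihilator of a path `q` is generated by `p`, up to the paths not composable with
`q`, if this holds for the paths in it. -/
theorem exists_eq_mul_of_mul_eq_zero {p q : P}
    (h : ∀ p', D.src p' = D.tgt q → D.b p' * D.b q = 0 → ∃ r, D.b p' = D.b r * D.b p)
    {x : R} (hx : x * D.b q = 0) : ∃ y, x * D.b (D.triv (D.tgt q)) = y * D.b p := by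
  have hmem : x * D.b (D.triv (D.tgt q)) ∈ LinearMap.range (LinearMap.mulRight k (D.b p)) := by
    refine D.mem_of_repr fun s hs => ?_
    have h0 : D.b s * D.b q = 0 :=
      D.mul_eq_zero_of_repr_ne_zero (by rw [mul_assoc, D.triv_mul, hx]) hs
    obtain ⟨r, hr⟩ := h s (D.repr_mul_triv hs) h0
    exact ⟨D.b r, hr.symm⟩
  obtain ⟨y, hy⟩ := hmem
  exact ⟨y, hy.symm⟩

theorem exists_eq_mul_of_mul_eq_zero' {p q : P}
    (h : ∀ p', D.tgt p' = D.src q → D.b q * D.b p' = 0 → ∃ r, D.b p' = D.b p * D.b r)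
    {x : R} (hx : D.b q * x = 0) : ∃ y, D.b (D.triv (D.src q)) * x = D.b p * y := by
  obtain ⟨y, hy⟩ := D.op.exists_eq_mul_of_mul_eq_zero (p := p) (q := q) (fun p' h1 h2 => by
    simp only [op_b, ← MulOpposite.op_mul, MulOpposite.op_eq_zero_iff, MulOpposite.op_inj] at h2 ⊢
    exact h p' h1 h2) (x := MulOpposite.op x) (by
    rw [op_b, ← MulOpposite.op_mul, hx, MulOpposite.op_zero])
  rw [op_b, op_b] at hy
  exact ⟨y.unop, congrArg MulOpposite.unop hy⟩

theorem IsPerfectPair.op {p q : P} (h : D.IsPerfectPair p q) : D.op.IsPerfectPair q p where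
  len_left := h.len_right
  len_right := h.len_left
  src_eq_tgt := h.src_eq_tgt.symm
  mul_eq_zero := by rw [op_b, op_b, ← MulOpposite.op_mul, h.mul_eq_zero, MulOpposite.op_zero]
  right_factor p' h1 h2 := by
    simp only [op_b, ← MulOpposite.op_mul, MulOpposite.op_eq_zero_iff, MulOpposite.op_inj] at h2 ⊢
    exact h.left_factor p' h1 h2
  left_factor p' h1 h2 := by
    simp only [op_b, ← MulOpposite.op_mul, MulOpposite.op_eq_zero_iff, MulOpposite.op_inj] at h2 ⊢
    exact h.right_factor p' h1 h2

variable (D)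

/-- The arrows, i.e. the paths of length one. -/
abbrev Arrow : Type _ := {a : P // D.len a = 1}

variable {D}

/-- The radical is generated by the arrows as a left ideal. -/
theorem exists_sum_arrow_eq {x : R} (hx : x ∈ D.radPow 1) :
    ∃ r : D.Arrow →₀ R, (r.sum fun a c => c * D.b a) = x := by
  have hle : D.radPow 1 ≤
      (LinearMap.range (Finsupp.linearCombination R fun a : D.Arrow => D.b a)).restrictScalars k := by
    rw [radPow, Submodule.span_le]
    rintro _ ⟨p, hp, rfl⟩
    obtain ⟨p', a, h, ha⟩ := D.exists_split p 1 hp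
    exact ⟨Finsupp.single ⟨a, ha⟩ (D.b p'), by simp [h]⟩
  obtain ⟨r, hr⟩ := hle hx
  rw [Finsupp.linearCombination_apply] at hr
  exact ⟨r, hr⟩

/-- The left ideals generated by the arrows are independent: a nontrivial path has only one first
arrow. -/
theorem mul_arrow_eq_zero_of_sum_eq_zero {r : D.Arrow →₀ R}
    (hr : (r.sum fun a c => c * D.b a) = 0) (a : D.Arrow) : r a * D.b a = 0 := by
  by_contra h0
  have hex : ∃ p, D.b.repr (r a * D.b a) p ≠ 0 := by
    by_contra! h
    exact h0 (D.b.repr.map_eq_zero_iff.1 (Finsupp.ext h))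
  obtain ⟨p, hp⟩ := hex
  have ha : a ∈ r.support := by
    rw [Finsupp.mem_support_iff]
    intro h
    rw [h, zero_mul] at h0
    exact h0 rfl
  have h1 : D.b.repr (r.sum fun a c => c * D.b a) p = D.b.repr (r a * D.b a) p := by
    rw [Finsupp.sum, map_sum, Finset.sum_apply', Finset.sum_eq_single_of_mem a ha]
    intro c _ hca
    by_contra hc
    obtain ⟨s, hs⟩ := D.exists_eq_mul_of_repr_mul_ne_zero hp
    obtain ⟨t, ht⟩ := D.exists_eq_mul_of_repr_mul_ne_zero hc
    exact hca (Subtype.ext (D.unique _ _ _ _ (ht.symm.trans hs) (ht ▸ D.ne_zero p)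
      (c.2.trans a.2.symm)).2)
  rw [hr, map_zero, Finsupp.zero_apply] at h1
  exact hp h1.symm

/-- The module `R / L` has a simple submodule, generated by the class of an element `x` which is
supported at one vertex. -/
theorem exists_radPow_mul_mem {L : Submodule R R} (hL : L ≠ ⊤) :
    ∃ x ∉ L, (∀ j ∈ D.radPow 1, j * x ∈ L) ∧ ∃ v, D.b (D.triv v) * x = x := by
  obtain ⟨m, hm⟩ := D.exists_radPow_eq_zero
  have hn : ∃ n, (∃ z ∈ D.radPow n, z ∉ L) ∧ ∀ z ∈ D.radPow (n + 1), z ∈ L := by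
    by_contra! h
    have : ∀ n, ∃ z ∈ D.radPow n, z ∉ L := by
      intro n
      induction n with
      | zero =>
        obtain ⟨z, -, hz⟩ := SetLike.exists_of_lt (lt_top_iff_ne_top.2 hL)
        exact ⟨z, D.mem_radPow_zero z, hz⟩
      | succ n ih => exact h n ih
    obtain ⟨z, hz, hzL⟩ := this m
    rw [hm z hz] at hzL
    exact hzL L.zero_mem
  obtain ⟨n, ⟨z, hz, hzL⟩, hn⟩ := hn
  have hv : ∃ v, D.b (D.triv v) * z ∉ L := by
    by_contra! h
    refine hzL ?_
    rw [← one_mul z, ← D.sum_triv, Finset.sum_mul]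
    exact L.sum_mem fun v _ => h v
  obtain ⟨v, hv⟩ := hv
  refine ⟨_, hv, fun j hj => ?_, v, ?_⟩
  · have h1 : j * D.b (D.triv v) ∈ D.radPow (1 + 0) := D.mul_mem_radPow hj (D.mem_radPow_zero _)
    rw [← mul_assoc]
    refine hn _ ?_
    rw [add_comm n 1]
    exact D.mul_mem_radPow h1 hz
  · have h1 := D.triv_mul (D.triv v)
    rw [D.tgt_triv] at h1
    rw [← mul_assoc, h1]

/-- If `x ∉ L` is supported at the vertex `v` and its class generates a simple submodule of `R / L`,
then an element carrying `x` into `L` lies in the radical, up to paths not starting at `v`. -/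
theorem mul_triv_mem_radPow_one {L : Submodule R R} {x : R} (hx : x ∉ L)
    (hj : ∀ j ∈ D.radPow 1, j * x ∈ L) {v : V} (hv : D.b (D.triv v) * x = x) {a : R}
    (ha : a * x ∈ L) : a * D.b (D.triv v) ∈ D.radPow 1 := by
  set c := D.b.repr (a * D.b (D.triv v)) (D.triv v) with hc
  have h1 : a * D.b (D.triv v) - c • D.b (D.triv v) ∈ D.radPow 1 := by
    rw [mem_radPow_iff]
    intro p hp
    rw [Nat.one_le_iff_ne_zero]
    intro hl
    have hpv : p = D.triv v := by
      have hs : D.src p = v := by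
        refine D.repr_mul_triv (x := a - algebraMap k R c) ?_
        rwa [sub_mul, ← Algebra.smul_def]
      rw [D.eq_triv p hl, hs]
    rw [hpv, map_sub, Finsupp.sub_apply, ← hc, map_smul, Finsupp.smul_apply,
      Module.Basis.repr_self, Finsupp.single_eq_same, smul_eq_mul, mul_one, sub_self] at hp
    exact hp rfl
  by_cases hc0 : c = 0
  · rwa [hc0, zero_smul, sub_zero] at h1
  · refine absurd ?_ hx
    have h2 : c • x ∈ L := by
      have h3 := L.sub_mem ha (hj _ h1)
      rwa [sub_mul, mul_assoc, hv, smul_mul_assoc, hv, sub_sub_cancel] at h3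
    have h4 := L.smul_mem (algebraMap k R c⁻¹) h2
    rwa [smul_eq_mul, ← Algebra.smul_def, smul_smul, inv_mul_cancel₀ hc0, one_smul] at h4

end Backward

section Injective

variable {k : Type*} {R : Type u} {V : Type*} {P : Type*} [Field k] [Ring R]
    [Algebra k R] [Fintype V] {D : PathBasis k R V P}

/-- An element of `E / R` which is annihilated by the left annihilator of the arrow `a` lifts to an
element of `E` with the same property, i.e. `Ext¹(Ra, R) = 0`, provided that `a` is not annihilated
by any path, or is the end of two consecutive perfect pairs. The two conditions on `c` say that
`a ↦ c` defines a homomorphism `Ra → E / R`. -/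
theorem exists_lift_of_arrow {E : Type*} [AddCommGroup E] [Module R E] (ι : R →ₗ[R] E)
    (hι : Function.Injective ι) {a : P}
    (ha : (∀ p, D.src p = D.tgt a → D.b p * D.b a ≠ 0) ∨
      ∃ p₁ p₀, D.IsPerfectPair p₁ a ∧ D.IsPerfectPair p₀ p₁)
    (c : E ⧸ LinearMap.range ι) (hc : D.b (D.triv (D.tgt a)) • c = c)
    (hc' : ∀ r : R, r * D.b a = 0 → r • c = 0) :
    ∃ ε : E, (LinearMap.range ι).mkQ ε = c ∧ ∀ r : R, r * D.b a = 0 → r • ε = 0 := by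
  obtain ⟨ε, rfl⟩ := Submodule.mkQ_surjective _ c
  obtain ha | ⟨p₁, p₀, h₁, h₀⟩ := ha
  · refine ⟨D.b (D.triv (D.tgt a)) • ε, by rw [map_smul, hc], fun r hr => ?_⟩
    have h0 : r * D.b (D.triv (D.tgt a)) = 0 := by
      refine D.b.repr.map_eq_zero_iff.1 (Finsupp.ext fun p => ?_)
      by_contra hp
      exact ha p (D.repr_mul_triv hp)
        (D.mul_eq_zero_of_repr_ne_zero (by rw [mul_assoc, D.triv_mul, hr]) hp)
    rw [← mul_smul, h0, zero_smul]
  · -- `p₁ • ε` lies in `R` and is annihilated by `p₀`, hence is a right multiple of `p₁`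
    have h1 := hc' _ h₁.mul_eq_zero
    rw [← map_smul] at h1
    obtain ⟨z, hz⟩ := (Submodule.Quotient.mk_eq_zero _).1 h1
    have h2 : D.b p₀ * z = 0 := by
      apply hι
      rw [← smul_eq_mul, map_smul, hz, ← mul_smul, h₀.mul_eq_zero, zero_smul, map_zero]
    have h3 : D.b (D.triv (D.tgt p₁)) * z = z := by
      apply hι
      rw [← smul_eq_mul, map_smul, hz, ← mul_smul, D.triv_mul]
    obtain ⟨y, hy⟩ := exists_eq_mul_of_mul_eq_zero' h₀.right_factor h2
    rw [h₀.src_eq_tgt, h3] at hy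
    refine ⟨D.b (D.triv (D.tgt a)) • (ε - ι y), ?_, fun r hr => ?_⟩
    · have h4 : (LinearMap.range ι).mkQ (ι y) = 0 :=
        (Submodule.Quotient.mk_eq_zero _).2 ⟨y, rfl⟩
      rw [map_smul, map_sub, h4, sub_zero, hc]
    · obtain ⟨s, hs⟩ := exists_eq_mul_of_mul_eq_zero h₁.left_factor hr
      rw [← mul_smul, hs, mul_smul, smul_sub, ← hz, hy, ← smul_eq_mul, map_smul, sub_self,
        smul_zero]

/-- If every arrow either is not annihilated by any path from the left, or is the end of two
consecutive perfect pairs, then the regular module has injective dimension at most one. -/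
theorem hasInjectiveDimensionLE_one
    (H : ∀ a, D.len a = 1 → (∀ p, D.src p = D.tgt a → D.b p * D.b a ≠ 0) ∨
      ∃ p₁ p₀, D.IsPerfectPair p₁ a ∧ D.IsPerfectPair p₀ p₁) :
    CategoryTheory.HasInjectiveDimensionLE (ModuleCat.of R R) 1 := by
  obtain ⟨E, _, _, ι, hE, hι⟩ := exists_injective_embedding R
  rw [hasInjectiveDimensionLE_one_iff ι hι]
  refine baer_of_forall_extend fun L hL f => ?_
  obtain ⟨x, hxL, hj, v, hv⟩ := D.exists_radPow_mul_mem hL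
  have hax : ∀ a : D.Arrow, D.b a * x ∈ L := fun a => hj _ (D.basis_mem_radPow a.2.ge)
  have hf : ∀ (r : R) (a : D.Arrow) (h : r * (D.b a * x) ∈ L),
      r • f ⟨D.b a * x, hax a⟩ = f ⟨r * (D.b a * x), h⟩ := fun r a h => by
    rw [← map_smul]
    rfl
  have hlift : ∀ a : D.Arrow, ∃ ε : E, (LinearMap.range ι).mkQ ε = f ⟨D.b a * x, hax a⟩ ∧
      ∀ r : R, r * D.b a = 0 → r • ε = 0 := by
    intro a
    refine exists_lift_of_arrow ι hι (H a a.2) _ ?_ fun r hr => ?_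
    · rw [hf _ _ (L.smul_mem _ (hax a))]
      congr 2
      rw [← mul_assoc, D.triv_mul]
    · rw [hf _ _ (L.smul_mem _ (hax a))]
      have h0 : (⟨r * (D.b a * x), L.smul_mem _ (hax a)⟩ : L) = 0 :=
        Subtype.ext (by simp [← mul_assoc, hr])
      rw [h0, map_zero]
  choose ε hε hε0 using hlift
  obtain ⟨y, hy⟩ := exists_smul_eq_of_injective (fun a : D.Arrow => D.b a) ε fun r hr =>
    Finset.sum_eq_zero fun a _ => hε0 a _ (mul_arrow_eq_zero_of_sum_eq_zero hr a)
  refine ⟨x, hxL, D.b (D.triv v) • (LinearMap.range ι).mkQ y, fun a ha => ?_⟩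
  obtain ⟨r, hr⟩ := exists_sum_arrow_eq (mul_triv_mem_radPow_one hxL hj hv ha)
  rw [← mul_smul, ← hr, Finsupp.sum, Finset.sum_smul]
  have h1 : (⟨a • x, ha⟩ : L) = ∑ i ∈ r.support, r i • ⟨D.b i * x, hax i⟩ := by
    apply Subtype.ext
    rw [AddSubmonoidClass.coe_finsetSum]
    simp only [Submodule.coe_smul, smul_eq_mul]
    conv_lhs => rw [← hv, ← mul_assoc, ← hr, Finsupp.sum, Finset.sum_mul]
    simp only [mul_assoc]
  rw [h1, map_sum]
  refine Finset.sum_congr rfl fun i _ => ?_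
  rw [map_smul, ← hε, ← hy, map_smul, mul_smul]

end Injective

end PathBasis

end BoundQuiver

/-! ### The path basis of a monomial algebra -/

namespace BoundQuiver

namespace QPath

variable {Q : Type u} [Quiver.{v} Q]

theorem length_concat (p q : QPath Q) (h : q.tgt = p.src) :
    (p.concat q h).length = p.length + q.length := by
  obtain ⟨a, b, p⟩ := p
  obtain ⟨c, d, q⟩ := q
  dsimp only at h
  subst h
  simp [concat, length, Quiver.Path.length_comp, add_comm]

theorem isSubpath_iff {p q : QPath Q} : p.IsSubpath q ↔
    ∃ (p'' p' : QPath Q) (h' : p'.tgt = p.src) (h'' : (p.concat p' h').tgt = p''.src),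
      q = p''.concat (p.concat p' h') h'' :=
  Iff.rfl

/-- A right multiple of a path which contains `s` still contains `s`. -/
theorem IsSubpath.concat_right {s p : QPath Q} (hs : s.IsSubpath p) (r : QPath Q)
    (h : r.tgt = p.src) : s.IsSubpath (p.concat r h) := by
  obtain ⟨p'', p', h', h'', rfl⟩ := isSubpath_iff.1 hs
  have h1 : r.tgt = (s.concat p' h').src := h
  have h2 : r.tgt = p'.src := h
  have h3 : (p'.concat r h2).tgt = s.src := h'
  have h4 : (s.concat (p'.concat r h2) h3).tgt = p''.src := h''
  refine isSubpath_iff.2 ⟨p'', p'.concat r h2, h3, h4, ?_⟩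
  rw [concat_assoc p'' _ r h'' h1]
  congr 1
  exact concat_assoc s p' r h' h2

theorem IsSubpath.concat_left {s p : QPath Q} (hs : s.IsSubpath p) (r : QPath Q)
    (h : p.tgt = r.src) : s.IsSubpath (r.concat p h) := by
  obtain ⟨p'', p', h', h'', rfl⟩ := isSubpath_iff.1 hs
  have h1 : p''.tgt = r.src := h
  exact isSubpath_iff.2 ⟨r.concat p'' h1, p', h', h'', (concat_assoc r p'' _ h1 h'').symm⟩

theorem eq_idem {p : QPath Q} (h : p.length = 0) : p = idem p.src := by
  obtain ⟨a, b, p⟩ := p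
  cases p with
  | nil => rfl
  | cons p e => simp [length] at h

theorem concat_of_length_eq_zero_left {p q : QPath Q} (h : q.tgt = p.src) (hp : p.length = 0) :
    p.concat q h = q := by
  obtain ⟨a, b, p⟩ := p
  obtain ⟨c, d, q⟩ := q
  cases p with
  | nil => exact idem_concat _ h
  | cons p e => simp [length] at hp

theorem concat_of_length_eq_zero_right {p q : QPath Q} (h : q.tgt = p.src) (hq : q.length = 0) :
    p.concat q h = p := by
  obtain ⟨a, b, p⟩ := p
  obtain ⟨c, d, q⟩ := q
  cases q with
  | nil => exact concat_idem _ h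
  | cons p e => simp [length] at hq

theorem isSubpath_refl (p : QPath Q) : p.IsSubpath p := by
  have h1 : (idem p.src).tgt = p.src := rfl
  have h2 : (p.concat (idem p.src) h1).tgt = (idem p.tgt).src := rfl
  refine isSubpath_iff.2 ⟨idem p.tgt, idem p.src, h1, h2, ?_⟩
  rw [concat_of_length_eq_zero_left h2 rfl, concat_of_length_eq_zero_right h1 rfl]

theorem eq_of_comp_eq {a b b' c : Q} (q : Quiver.Path a b) (p : Quiver.Path b c)
    (q' : Quiver.Path a b') (p' : Quiver.Path b' c) (h : q.comp p = q'.comp p')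
    (hl : p.length = p'.length) :
    (⟨b, c, p⟩ : QPath Q) = ⟨b', c, p'⟩ ∧ (⟨a, b, q⟩ : QPath Q) = ⟨a, b', q'⟩ := by
  induction p with
  | nil =>
    cases p' with
    | nil =>
      simp only [Quiver.Path.comp_nil] at h
      exact ⟨rfl, by rw [h]⟩
    | cons p' e' => simp at hl
  | cons p e ih =>
    cases p' with
    | nil => simp at hl
    | cons p' e' =>
      simp only [Quiver.Path.length_cons, Nat.add_right_cancel_iff] at hl
      simp only [Quiver.Path.comp_cons, Quiver.Path.cons.injEq] at h
      obtain ⟨rfl, h1, h2⟩ := h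
      obtain ⟨h3, h4⟩ := ih p' (eq_of_heq h1) hl
      obtain rfl := eq_of_heq h2
      refine ⟨?_, h4⟩
      simp only [QPath.mk.injEq] at h3
      obtain ⟨rfl, -, h3⟩ := h3
      obtain rfl := eq_of_heq h3
      rfl

/-- A path determines its factors once their lengths are known. -/
theorem concat_inj {p q p' q' : QPath Q} {h : q.tgt = p.src} {h' : q'.tgt = p'.src}
    (heq : p.concat q h = p'.concat q' h') (hl : q.length = q'.length) : p = p' ∧ q = q' := by
  have hlen := congrArg length heq
  rw [length_concat, length_concat] at hlen
  obtain ⟨a, b, p⟩ := p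
  obtain ⟨c, d, q⟩ := q
  obtain ⟨a', b', p'⟩ := p'
  obtain ⟨c', d', q'⟩ := q'
  dsimp only at h h'
  subst h h'
  simp only [concat, QPath.mk.injEq] at heq
  obtain ⟨rfl, rfl, heq⟩ := heq
  exact eq_of_comp_eq _ _ _ _ (eq_of_heq heq) (by simp only [length] at hlen hl; omega)

theorem exists_split (p : QPath Q) (n : ℕ) (hn : n ≤ p.length) :
    ∃ (p' p'' : QPath Q) (h : p''.tgt = p'.src), p = p'.concat p'' h ∧ p''.length = n := by
  obtain ⟨a, b, p⟩ := p
  induction p with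
  | nil =>
    refine ⟨idem a, idem a, rfl, rfl, ?_⟩
    simp only [length, Quiver.Path.length_nil, Nat.le_zero] at hn
    exact hn.symm
  | @cons b c p e ih =>
    obtain rfl | hlt := eq_or_lt_of_le hn
    · exact ⟨idem c, ⟨a, c, p.cons e⟩, rfl, (idem_concat _ rfl).symm, rfl⟩
    · obtain ⟨⟨a', b', p'⟩, ⟨c', d', p''⟩, h, h1, h2⟩ := ih (Nat.lt_succ_iff.1 hlt)
      dsimp only at h
      subst h
      simp only [concat, QPath.mk.injEq] at h1
      obtain ⟨rfl, rfl, h1⟩ := h1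
      obtain rfl := eq_of_heq h1
      exact ⟨⟨d', c, p'.cons e⟩, ⟨a, d', p''⟩, rfl, rfl, h2⟩

theorem finite_length_eq [Finite Q] [∀ a b : Q, Finite (a ⟶ b)] (n : ℕ) :
    Finite {p : QPath Q // p.length = n} := by
  induction n with
  | zero =>
    refine Finite.of_surjective (fun i : Q => (⟨idem i, rfl⟩ : {p : QPath Q // p.length = 0})) ?_
    rintro ⟨p, hp⟩
    exact ⟨p.src, Subtype.ext (eq_idem hp).symm⟩
  | succ n ih =>
    refine Finite.of_surjective
      (fun x : Σ (p : {p : QPath Q // p.length = n}) (c : Q), (p.1.tgt ⟶ c) =>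
        (⟨⟨x.1.1.src, x.2.1, x.1.1.path.cons x.2.2⟩, congrArg Nat.succ x.1.2⟩ :
          {p : QPath Q // p.length = n + 1})) ?_
    rintro ⟨⟨a, b, p⟩, hp⟩
    cases p with
    | nil => simp [length] at hp
    | cons p e => exact ⟨⟨⟨⟨_, _, p⟩, Nat.succ.inj hp⟩, _, e⟩, rfl⟩

end QPath

section Monomial

open PathAlgebra

variable {k : Type w} [Field k] {Q : Type u} [Quiver.{v} Q]

theorem ofPath_concat (p q : QPath Q) (h : q.tgt = p.src) :
    ofPath k (p.concat q h) = ofPath k p * ofPath k q := by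
  rw [ofPath_mul_ofPath, basisMul, dif_pos h]

theorem ofPath_mul_ofPath_of_ne {p q : QPath Q} (h : q.tgt ≠ p.src) :
    ofPath k p * ofPath k q = 0 := by
  rw [ofPath_mul_ofPath, basisMul, dif_neg h]

variable [Fintype Q] {I : TwoSidedIdeal (PathAlgebra k Q)}

theorem ofPath_mem_of_isSubpath {p q : QPath Q} (h : p.IsSubpath q) (hp : ofPath k p ∈ I) :
    ofPath k q ∈ I := by
  obtain ⟨p'', p', h', h'', rfl⟩ := QPath.isSubpath_iff.1 h
  rw [ofPath_concat, ofPath_concat]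
  exact I.mul_mem_left _ _ (I.mul_mem_right _ _ hp)

/-- The paths occurring in an element of the ideal generated by a set `S` of paths contain
subpaths from `S`. -/
theorem exists_isSubpath_of_mem_span {S : Set (QPath Q)} {x : PathAlgebra k Q}
    (hx : x ∈ TwoSidedIdeal.span (ofPath k '' S)) {p : QPath Q}
    (hp : (basis k Q).repr x p ≠ 0) : ∃ s ∈ S, s.IsSubpath p := by
  let T : Submodule k (PathAlgebra k Q) :=
    Submodule.span k (basis k Q '' {p | ∃ s ∈ S, s.IsSubpath p})
  have hl : ∀ x y, y ∈ T → x * y ∈ T := by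
    intro x y hy
    have : T ≤ T.comap (LinearMap.mulLeft k x) := by
      rw [Submodule.span_le]
      rintro _ ⟨q, ⟨s, hs, hsq⟩, rfl⟩
      rw [SetLike.mem_coe, Submodule.mem_comap, LinearMap.mulLeft_apply, basis_apply]
      induction x using induction_on with
      | h0 => rw [zero_mul]; exact T.zero_mem
      | hadd x y hx hy => rw [add_mul]; exact T.add_mem hx hy
      | hs c r =>
        rw [smul_mul_assoc]
        refine T.smul_mem _ ?_
        by_cases h : q.tgt = r.src
        · rw [← ofPath_concat r q h]
          exact Submodule.subset_span ⟨_, ⟨s, hs, hsq.concat_left r h⟩, rfl⟩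
        · rw [ofPath_mul_ofPath_of_ne h]
          exact T.zero_mem
    exact this hy
  have hr : ∀ x y, x ∈ T → x * y ∈ T := by
    intro x y hx
    have : T ≤ T.comap (LinearMap.mulRight k y) := by
      rw [Submodule.span_le]
      rintro _ ⟨q, ⟨s, hs, hsq⟩, rfl⟩
      rw [SetLike.mem_coe, Submodule.mem_comap, LinearMap.mulRight_apply, basis_apply]
      induction y using induction_on with
      | h0 => rw [mul_zero]; exact T.zero_mem
      | hadd x y hx hy => rw [mul_add]; exact T.add_mem hx hy
      | hs c r =>
        rw [mul_smul_comm]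
        refine T.smul_mem _ ?_
        by_cases h : r.tgt = q.src
        · rw [← ofPath_concat q r h]
          exact Submodule.subset_span ⟨_, ⟨s, hs, hsq.concat_right r h⟩, rfl⟩
        · rw [ofPath_mul_ofPath_of_ne h]
          exact T.zero_mem
    exact this hx
  let T' : TwoSidedIdeal (PathAlgebra k Q) := TwoSidedIdeal.mk' T T.zero_mem T.add_mem T.neg_mem
    (fun {x y} h => hl x y h) (fun {x y} h => hr x y h)
  have hle : TwoSidedIdeal.span (ofPath k '' S) ≤ T' := by
    rw [TwoSidedIdeal.span_le]
    rintro _ ⟨s, hs, rfl⟩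
    rw [SetLike.mem_coe, TwoSidedIdeal.mem_mk']
    exact Submodule.subset_span ⟨s, ⟨s, hs, s.isSubpath_refl⟩, rfl⟩
  have hxT : x ∈ T := (TwoSidedIdeal.mem_mk' _ _ _ _ _ _ _).1 (hle hx)
  rw [Module.Basis.mem_span_image] at hxT
  exact hxT (Finsupp.mem_support_iff.2 hp)

/-- A monomial ideal is spanned by the paths it contains. -/
theorem IsMonomial.ofPath_mem (hI : IsMonomial I) {x : PathAlgebra k Q} (hx : x ∈ I) {p : QPath Q}
    (hp : (basis k Q).repr x p ≠ 0) : ofPath k p ∈ I := by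
  obtain ⟨-, S, -, rfl⟩ := hI
  obtain ⟨s, hs, hsp⟩ := exists_isSubpath_of_mem_span hx hp
  exact ofPath_mem_of_isSubpath hsp (TwoSidedIdeal.subset_span ⟨s, hs, rfl⟩)

theorem IsMonomial.two_le_length (hI : IsMonomial I) {p : QPath Q} (hp : ofPath k p ∈ I) :
    2 ≤ p.length := by
  obtain ⟨-, S, hS, rfl⟩ := hI
  obtain ⟨s, hs, hsp⟩ := exists_isSubpath_of_mem_span hp (p := p) (by
    rw [← basis_apply, Module.Basis.repr_self, Finsupp.single_eq_same]
    exact one_ne_zero)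
  obtain ⟨p'', p', h', h'', rfl⟩ := QPath.isSubpath_iff.1 hsp
  rw [QPath.length_concat, QPath.length_concat]
  have := hS s hs
  omega

theorem IsMonomial.exists_length_lt (hI : IsMonomial I) :
    ∃ m, ∀ p : QPath Q, IsNonzeroPath I p → p.length < m := by
  obtain ⟨⟨⟨m, -, hm⟩, -⟩, -⟩ := hI
  refine ⟨m, fun p hp => ?_⟩
  by_contra! h
  exact hp (hm (TwoSidedIdeal.subset_span ⟨p, h, rfl⟩))

theorem IsMonomial.finite_nonzeroPath [∀ a b : Q, Finite (a ⟶ b)] (hI : IsMonomial I) :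
    Finite {p : QPath Q // IsNonzeroPath I p} := by
  obtain ⟨m, hm⟩ := hI.exists_length_lt
  have := QPath.finite_length_eq (Q := Q)
  refine Finite.of_injective (β := Σ n : Fin m, {p : QPath Q // p.length = n})
    (fun p => ⟨⟨p.1.length, hm p.1 p.2⟩, p.1, rfl⟩) ?_
  rintro ⟨p, hp⟩ ⟨q, hq⟩ h
  have h1 := congrArg (fun x : Σ n : Fin m, {p : QPath Q // p.length = n} => x.2.1) h
  exact Subtype.ext h1

/-- The image of a path in `kQ / I`. -/
noncomputable def pathImage (I : TwoSidedIdeal (PathAlgebra k Q)) (p : QPath Q) :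
    QuotientAlgebra I :=
  I.ringCon.mkₐ k (ofPath k p)

theorem mk_eq_zero_iff {x : PathAlgebra k Q} : I.ringCon.mkₐ k x = 0 ↔ x ∈ I := by
  rw [TwoSidedIdeal.mem_iff]
  exact I.ringCon.eq

theorem pathImage_eq_zero_iff {p : QPath Q} : pathImage I p = 0 ↔ ofPath k p ∈ I :=
  mk_eq_zero_iff

theorem pathImage_concat (p q : QPath Q) (h : q.tgt = p.src) :
    pathImage I (p.concat q h) = pathImage I p * pathImage I q := by
  rw [pathImage, ofPath_concat, map_mul]
  rfl

theorem pathImage_mul_of_ne {p q : QPath Q} (h : q.tgt ≠ p.src) :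
    pathImage I p * pathImage I q = 0 := by
  rw [pathImage, pathImage, ← map_mul, ofPath_mul_ofPath_of_ne h, map_zero]

theorem pathImage_mul_eq_zero_or (p q : QPath Q) : pathImage I p * pathImage I q = 0 ∨
    ∃ h, pathImage I p * pathImage I q = pathImage I (p.concat q h) ∧
      IsNonzeroPath I (p.concat q h) := by
  by_cases h : q.tgt = p.src
  · by_cases h0 : ofPath k (p.concat q h) ∈ I
    · left
      rw [← pathImage_concat p q h, pathImage_eq_zero_iff.2 h0]
    · exact Or.inr ⟨h, (pathImage_concat p q h).symm, h0⟩
  · exact Or.inl (pathImage_mul_of_ne h)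

theorem linearIndependent_pathImage (hI : IsMonomial I) :
    LinearIndependent k fun p : {p : QPath Q // IsNonzeroPath I p} => pathImage I p.1 := by
  rw [linearIndependent_iff]
  intro l hl
  have h1 : Finsupp.linearCombination k
      (fun p : {p : QPath Q // IsNonzeroPath I p} => basis k Q p.1) l ∈ I := by
    rw [← mk_eq_zero_iff, ← hl, Finsupp.linearCombination_apply, Finsupp.linearCombination_apply,
      map_finsuppSum]
    simp only [map_smul]
    rfl
  ext p
  by_contra hp
  refine p.2 (hI.ofPath_mem h1 ?_)
  have h2 : Finsupp.linearCombination k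
      (fun p : {p : QPath Q // IsNonzeroPath I p} => basis k Q p.1) l =
      Finsupp.linearCombination k (basis k Q) (l.mapDomain Subtype.val) := by
    rw [Finsupp.linearCombination_mapDomain]
    rfl
  rw [h2, Module.Basis.repr_linearCombination, Finsupp.mapDomain_apply Subtype.val_injective]
  exact hp

theorem span_pathImage :
    ⊤ ≤ Submodule.span k
      (Set.range fun p : {p : QPath Q // IsNonzeroPath I p} => pathImage I p.1) := by
  rintro x -
  obtain ⟨x, rfl⟩ := I.ringCon.mkₐ_surjective (α := k) x
  induction x using induction_on with
  | h0 => rw [map_zero]; exact Submodule.zero_mem _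
  | hadd x y hx hy => rw [map_add]; exact Submodule.add_mem _ hx hy
  | hs c p =>
    rw [map_smul]
    refine Submodule.smul_mem _ _ ?_
    by_cases hp : ofPath k p ∈ I
    · rw [mk_eq_zero_iff.2 hp]
      exact Submodule.zero_mem _
    · exact Submodule.subset_span ⟨⟨p, hp⟩, rfl⟩

/-- The nonzero paths form a path basis of the monomial algebra `kQ / I`. -/
noncomputable def pathBasis (hI : IsMonomial I) :
    PathBasis k (QuotientAlgebra I) Q {p : QPath Q // IsNonzeroPath I p} :=
  let B := Module.Basis.mk (linearIndependent_pathImage hI) span_pathImage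
  have hB : ∀ p, B p = pathImage I p.1 := fun p => Module.Basis.mk_apply _ _ p
  { b := B
    src := fun p => p.1.src
    tgt := fun p => p.1.tgt
    len := fun p => p.1.length
    triv := fun i => ⟨QPath.idem i, fun h => by
      have := hI.two_le_length h
      simp [QPath.idem, QPath.length] at this⟩
    mul_eq_zero_or := fun p q => by
      simp only [hB]
      obtain h | ⟨h, h1, h2⟩ := pathImage_mul_eq_zero_or (I := I) p.1 q.1
      · exact Or.inl h
      · exact Or.inr ⟨⟨p.1.concat q.1 h, h2⟩, h1, rfl, rfl, QPath.length_concat _ _ h⟩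
    src_eq_tgt := fun p q h => by
      simp only [hB] at h
      by_contra hne
      exact h (pathImage_mul_of_ne (Ne.symm hne))
    mul_triv := fun p => by
      simp only [hB]
      have h : (QPath.idem p.1.src).tgt = p.1.src := rfl
      rw [← pathImage_concat p.1 (QPath.idem p.1.src) h,
        QPath.concat_of_length_eq_zero_right h rfl]
    triv_mul := fun p => by
      simp only [hB]
      rw [← pathImage_concat (QPath.idem p.1.tgt) p.1 rfl, QPath.idem_concat]
    src_triv := fun _ => rfl
    tgt_triv := fun _ => rfl
    len_triv := fun _ => rfl
    eq_triv := fun p h => Subtype.ext (QPath.eq_idem h)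
    unique := fun p q p' q' h h0 hl => by
      simp only [hB] at h h0
      obtain h1 | ⟨h1, h2, h3⟩ := pathImage_mul_eq_zero_or (I := I) p.1 q.1
      · exact absurd h1 h0
      obtain h1' | ⟨h1', h2', h3'⟩ := pathImage_mul_eq_zero_or (I := I) p'.1 q'.1
      · exact absurd (h.trans h1') h0
      rw [h2, h2'] at h
      have h4 := (linearIndependent_pathImage hI).injective.eq_iff
        (a := ⟨_, h3⟩) (b := ⟨_, h3'⟩) |>.1 h
      obtain ⟨h5, h6⟩ := QPath.concat_inj (congrArg Subtype.val h4) hl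
      exact ⟨Subtype.ext h5, Subtype.ext h6⟩
    exists_split := fun p n hn => by
      obtain ⟨p', p'', h, h1, h2⟩ := QPath.exists_split p.1 n hn
      have hp := p.2
      rw [IsNonzeroPath, h1, ofPath_concat] at hp
      refine ⟨⟨p', fun h0 => hp (I.mul_mem_right _ _ h0)⟩,
        ⟨p'', fun h0 => hp (I.mul_mem_left _ _ h0)⟩, ?_, h2⟩
      simp only [hB]
      rw [← pathImage_concat _ _ h, ← h1]
    bounded := by
      obtain ⟨m, hm⟩ := hI.exists_length_lt
      exact ⟨m, fun p => hm p.1 p.2⟩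
    sum_triv := by
      simp only [hB]
      exact (map_sum (I.ringCon.mkₐ k) _ _).symm.trans (map_one (I.ringCon.mkₐ k)) }

theorem pathBasis_b (hI : IsMonomial I) (p : {p : QPath Q // IsNonzeroPath I p}) :
    (pathBasis hI).b p = pathImage I p.1 :=
  Module.Basis.mk_apply (linearIndependent_pathImage hI) span_pathImage p

end Monomial

end BoundQuiver

/-! ### Minimal paths and perfect pairs of a monomial algebra -/

namespace BoundQuiver

section Translation

open PathAlgebra

variable {k : Type w} [Field k] {Q : Type u} [Quiver.{v} Q] [Fintype Q]
  {I : TwoSidedIdeal (PathAlgebra k Q)} (hI : IsMonomial I)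

theorem pathBasis_mul_eq_zero_iff {p q : {p : QPath Q // IsNonzeroPath I p}}
    (h : q.1.tgt = p.1.src) :
    (pathBasis hI).b p * (pathBasis hI).b q = 0 ↔ ofPath k (p.1.concat q.1 h) ∈ I := by
  rw [pathBasis_b, pathBasis_b, ← pathImage_concat _ _ h, pathImage_eq_zero_iff]

theorem pathBasis_eq_mul_iff {p q r : {p : QPath Q // IsNonzeroPath I p}} :
    (pathBasis hI).b r = (pathBasis hI).b p * (pathBasis hI).b q ↔
      ∃ h, r.1 = p.1.concat q.1 h := by
  constructor
  · intro h
    have h1 := ((pathBasis hI).of_eq_mul h).1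
    refine ⟨h1.symm, ?_⟩
    rw [pathBasis_b, pathBasis_b, pathBasis_b] at h
    obtain h2 | ⟨h2, h3, h4⟩ := pathImage_mul_eq_zero_or (I := I) p.1 q.1
    · rw [h2, pathImage_eq_zero_iff] at h
      exact absurd h r.2
    · exact congrArg Subtype.val ((linearIndependent_pathImage hI).injective.eq_iff
        (a := r) (b := ⟨_, h4⟩) |>.1 (h.trans h3))
  · rintro ⟨h, hr⟩
    rw [pathBasis_b, pathBasis_b, pathBasis_b, hr, pathImage_concat _ _ h]

theorem isNonzeroPath_of_concat {p q : QPath Q} {h : q.tgt = p.src}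
    (hpq : IsNonzeroPath I (p.concat q h)) : IsNonzeroPath I p ∧ IsNonzeroPath I q := by
  rw [IsNonzeroPath, ofPath_concat] at hpq
  exact ⟨fun h => hpq (I.mul_mem_right _ _ h), fun h => hpq (I.mul_mem_left _ _ h)⟩

theorem pathBasis_isPerfectPair_iff {p q : {p : QPath Q // IsNonzeroPath I p}} :
    (pathBasis hI).IsPerfectPair p q ↔ IsPerfectPair I p.1 q.1 := by
  constructor
  · intro H
    refine ⟨p.2, q.2, H.len_left, H.len_right, ⟨H.src_eq_tgt.symm, ?_⟩, ?_, ?_⟩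
    · exact (pathBasis_mul_eq_zero_iff hI H.src_eq_tgt.symm).1 H.mul_eq_zero
    · intro q' h hq' h0
      obtain ⟨r, hr⟩ := H.right_factor ⟨q', hq'⟩ h ((pathBasis_mul_eq_zero_iff hI h).2 h0)
      exact ⟨r.1, (pathBasis_eq_mul_iff hI).1 hr⟩
    · intro p' h hp' h0
      obtain ⟨r, hr⟩ := H.left_factor ⟨p', hp'⟩ h.symm ((pathBasis_mul_eq_zero_iff hI h).2 h0)
      exact ⟨r.1, (pathBasis_eq_mul_iff hI).1 hr⟩
  · intro H
    obtain ⟨h, h0⟩ := H.concat_eq_zero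
    refine ⟨H.nontrivial_left, H.nontrivial_right, h.symm,
      (pathBasis_mul_eq_zero_iff hI h).2 h0, ?_, ?_⟩
    · intro q' h' h0'
      obtain ⟨r, hr, hqr⟩ := H.right_factor q'.1 h' q'.2 ((pathBasis_mul_eq_zero_iff hI h').1 h0')
      have hrn : IsNonzeroPath I r := (isNonzeroPath_of_concat (hqr ▸ q'.2)).2
      exact ⟨⟨r, hrn⟩, (pathBasis_eq_mul_iff hI).2 ⟨hr, hqr⟩⟩
    · intro p' h' h0'
      obtain ⟨r, hr, hpr⟩ := H.left_factor p'.1 h'.symm p'.2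
        ((pathBasis_mul_eq_zero_iff hI h'.symm).1 h0')
      have hrn : IsNonzeroPath I r := (isNonzeroPath_of_concat (hpr ▸ p'.2)).1
      exact ⟨⟨r, hrn⟩, (pathBasis_eq_mul_iff hI).2 ⟨hr, hpr⟩⟩

/-- If `pq` is a minimal path in `I`, then `p` is a minimal left annihilator of `q`. -/
theorem isLeftMinimal_of_mem_minimalPaths {p q : {p : QPath Q // IsNonzeroPath I p}}
    (h : q.1.tgt = p.1.src) (hpq : p.1.concat q.1 h ∈ minimalPaths I) :
    (pathBasis hI).IsLeftMinimal p q := by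
  refine ⟨h.symm, (pathBasis_mul_eq_zero_iff hI h).2 hpq.1, fun r t hrt ht => ?_⟩
  obtain ⟨h1, h2⟩ := (pathBasis_eq_mul_iff hI).1 hrt
  have h3 : q.1.tgt = t.1.src := by
    have := congrArg QPath.src h2
    exact h.trans this
  rw [pathBasis_mul_eq_zero_iff hI h3] at ht
  have h4 : (t.1.concat q.1 h3).tgt = r.1.src := h1
  have h5 : p.1.concat q.1 h = r.1.concat (t.1.concat q.1 h3) h4 := by
    rw [← QPath.concat_assoc r.1 t.1 q.1 h1 h3]
    congr 1
  have hsub : (t.1.concat q.1 h3).IsSubpath (p.1.concat q.1 h) := by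
    rw [h5]
    exact (QPath.isSubpath_refl _).concat_left r.1 h4
  by_contra hr
  refine hpq.2 _ hsub (fun heq => hr ?_) ht
  have h6 := congrArg QPath.length h5
  rw [← heq, QPath.length_concat r.1] at h6
  change r.1.length = 0
  omega

/-- A path `pq` in `I` with `p`, `q` nonzero is a minimal path in `I` as soon as it stays nonzero
when it is shortened within `p` at the left end, or within `q` at the right end. -/
theorem mem_minimalPaths_of_minimal {p q : QPath Q} (hp : IsNonzeroPath I p)
    (hq : IsNonzeroPath I q) (h : q.tgt = p.src) (h0 : ofPath k (p.concat q h) ∈ I)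
    (hl : ∀ (r t : QPath Q) (h₁ : t.tgt = r.src) (h₂ : q.tgt = t.src), p = r.concat t h₁ →
      ofPath k (t.concat q h₂) ∈ I → r.length = 0)
    (hr : ∀ (r t : QPath Q) (h₁ : t.tgt = r.src) (h₂ : r.tgt = p.src), q = r.concat t h₁ →
      ofPath k (p.concat r h₂) ∈ I → t.length = 0) :
    p.concat q h ∈ minimalPaths I := by
  refine ⟨h0, fun z hz hne hzI => hne ?_⟩
  obtain ⟨x, y, h1, h2, heq⟩ := QPath.isSubpath_iff.1 hz
  have hlen := congrArg QPath.length heq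
  rw [QPath.length_concat, QPath.length_concat x, QPath.length_concat z] at hlen
  have hx : x.length = 0 := by
    by_contra hx
    have huI : ofPath k (z.concat y h1) ∈ I := by
      rw [ofPath_concat]
      exact I.mul_mem_right _ _ hzI
    obtain hle | hlt := le_total q.length (z.concat y h1).length
    · obtain ⟨t, q', ht, hzy, hl'⟩ := QPath.exists_split _ _ hle
      rw [hzy] at huI
      have h3 : t.tgt = x.src := by
        have := congrArg QPath.tgt hzy
        exact this.symm.trans h2
      have h4 : p.concat q h = (x.concat t h3).concat q' ht := by
        rw [heq, QPath.concat_assoc x t q' h3 ht]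
        congr 1
      obtain ⟨h5, rfl⟩ := QPath.concat_inj h4 hl'.symm
      exact hx (hl x t h3 ht h5 huI)
    · obtain ⟨q₁, q₂, h3, hq12, hl'⟩ := QPath.exists_split _ _ hlt
      have h4 : q₁.tgt = p.src := (congrArg QPath.tgt hq12).symm.trans h
      have h5 : (p.concat q₁ h4).concat q₂ h3 = x.concat (z.concat y h1) h2 := by
        rw [← heq, QPath.concat_assoc p q₁ q₂ h4 h3]
        congr 1
        exact hq12.symm
      obtain ⟨-, rfl⟩ := QPath.concat_inj h5 hl'
      refine hq ?_
      rw [hq12, ofPath_concat]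
      exact I.mul_mem_left _ _ huI
  have hy : y.length = 0 := by
    by_contra hy
    have h2' : z.tgt = x.src := h2
    have huI : ofPath k (x.concat z h2') ∈ I := by
      rw [ofPath_concat]
      exact I.mul_mem_left _ _ hzI
    have heq' : p.concat q h = (x.concat z h2').concat y h1 := by
      rw [heq, QPath.concat_assoc x z y h2' h1]
    rw [QPath.concat_of_length_eq_zero_left h2' hx] at huI
    have heq'' : p.concat q h = z.concat y h1 := by
      rw [heq, QPath.concat_of_length_eq_zero_left h2 hx]
    obtain hle | hlt := le_total y.length q.length
    · obtain ⟨r, y', hr', hq', hl'⟩ := QPath.exists_split _ _ hle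
      have h3 : r.tgt = p.src := (congrArg QPath.tgt hq').symm.trans h
      have h4 : (p.concat r h3).concat y' hr' = z.concat y h1 := by
        rw [← heq'', QPath.concat_assoc p r y' h3 hr']
        congr 1
        exact hq'.symm
      obtain ⟨rfl, rfl⟩ := QPath.concat_inj h4 hl'
      exact hy (hr r y' hr' h3 hq' huI)
    · obtain ⟨y₁, y₂, h3, hy12, hl'⟩ := QPath.exists_split _ _ hlt
      have h4 : y₁.tgt = z.src := (congrArg QPath.tgt hy12).symm.trans h1
      have h5 : p.concat q h = (z.concat y₁ h4).concat y₂ h3 := by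
        rw [heq'', QPath.concat_assoc z y₁ y₂ h4 h3]
        congr 1
      obtain ⟨rfl, -⟩ := QPath.concat_inj h5 hl'.symm
      refine hp ?_
      rw [ofPath_concat]
      exact I.mul_mem_right _ _ huI
  rw [heq, QPath.concat_of_length_eq_zero_left h2 hx, QPath.concat_of_length_eq_zero_right h1 hy]

/-- A minimal left annihilator `p` of an arrow `a` yields a minimal path `pa` in `I`. -/
theorem mem_minimalPaths_of_isLeftMinimal {p a : {p : QPath Q // IsNonzeroPath I p}}
    (ha : a.1.length = 1) (hp : (pathBasis hI).IsLeftMinimal p a) :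
    p.1.concat a.1 hp.src_eq_tgt.symm ∈ minimalPaths I := by
  refine mem_minimalPaths_of_minimal p.2 a.2 _
    ((pathBasis_mul_eq_zero_iff hI hp.src_eq_tgt.symm).1 hp.mul_eq_zero) ?_ ?_
  · intro r t h₁ h₂ hprt h0
    have hn := isNonzeroPath_of_concat (hprt ▸ p.2)
    exact hp.minimal ⟨r, hn.1⟩ ⟨t, hn.2⟩ ((pathBasis_eq_mul_iff hI).2 ⟨h₁, hprt⟩)
      ((pathBasis_mul_eq_zero_iff hI (p := ⟨t, hn.2⟩) h₂).2 h0)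
  · intro r t h₁ h₂ hart h0
    by_contra ht
    have hl := congrArg QPath.length hart
    rw [ha, QPath.length_concat] at hl
    rw [QPath.concat_of_length_eq_zero_right h₂ (by omega)] at h0
    exact p.2 h0

/-- The mirror image of `mem_minimalPaths_of_isLeftMinimal`. -/
theorem mem_minimalPaths_of_op_isLeftMinimal {p a : {p : QPath Q // IsNonzeroPath I p}}
    (ha : a.1.length = 1) (hp : (pathBasis hI).op.IsLeftMinimal p a) :
    a.1.concat p.1 hp.src_eq_tgt ∈ minimalPaths I := by
  have h00 := hp.mul_eq_zero
  rw [PathBasis.op_b, PathBasis.op_b, ← MulOpposite.op_mul, MulOpposite.op_eq_zero_iff] at h00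
  refine mem_minimalPaths_of_minimal a.2 p.2 _
    ((pathBasis_mul_eq_zero_iff hI hp.src_eq_tgt).1 h00) ?_ ?_
  · intro r t h₁ h₂ hart h0
    by_contra ht
    have hl := congrArg QPath.length hart
    rw [ha, QPath.length_concat] at hl
    rw [QPath.concat_of_length_eq_zero_left h₂ (by omega)] at h0
    exact p.2 h0
  · intro r t h₁ h₂ hprt h0
    have hn := isNonzeroPath_of_concat (hprt ▸ p.2)
    refine hp.minimal ⟨t, hn.2⟩ ⟨r, hn.1⟩ ?_ ?_
    · rw [PathBasis.op_b, PathBasis.op_b, PathBasis.op_b, ← MulOpposite.op_mul,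
        MulOpposite.op_inj]
      exact (pathBasis_eq_mul_iff hI).2 ⟨h₁, hprt⟩
    · rw [PathBasis.op_b, PathBasis.op_b, ← MulOpposite.op_mul, MulOpposite.op_eq_zero_iff]
      exact (pathBasis_mul_eq_zero_iff hI (q := ⟨r, hn.1⟩) h₂).2 h0

/-- If `pa` is zero for an arrow `a`, then `a` is the only path that can form a perfect pair
`(p, q)` with `p`. -/
theorem IsPerfectPair.eq_of_length_eq_one {p q a : QPath Q} (H : IsPerfectPair I p q)
    (ha : IsNonzeroPath I a) (hl : a.length = 1) (h : a.tgt = p.src)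
    (h0 : ofPath k (p.concat a h) ∈ I) : q = a := by
  obtain ⟨r, hr, rfl⟩ := H.right_factor a h ha h0
  rw [QPath.length_concat] at hl
  have := H.nontrivial_right
  rw [QPath.concat_of_length_eq_zero_right hr (by omega)]

/-- An arrow `a` annihilated by a path from the left has a minimal left annihilator `p₁`; as `p₁` is
perfect, `(p₁, a)` is a perfect pair, and so is `(p₀, p₁)` with `p₀` the predecessor of `p₁` on its
cycle. -/
theorem hasInjectiveDimensionLE_one_left (hI : IsMonomial I)
    (hC : ∀ p : QPath Q, IsNonzeroPath I p →
      (∃ (q : QPath Q) (h : q.tgt = p.src), IsNonzeroPath I q ∧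
        p.concat q h ∈ minimalPaths I) → IsPerfectPath I p) :
    CategoryTheory.HasInjectiveDimensionLE
      (ModuleCat.of (QuotientAlgebra I) (QuotientAlgebra I)) 1 := by
  refine (pathBasis hI).hasInjectiveDimensionLE_one fun a ha => ?_
  by_cases hex : ∃ p, (pathBasis hI).src p = (pathBasis hI).tgt a ∧
      (pathBasis hI).b p * (pathBasis hI).b a = 0
  · right
    obtain ⟨p, hp1, hp2⟩ := hex
    obtain ⟨p₁, hp₁⟩ := PathBasis.exists_isLeftMinimal hp1 hp2
    have hF := mem_minimalPaths_of_isLeftMinimal hI ha hp₁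
    obtain ⟨n, s, hn, hs0, hsn, hs⟩ := hC p₁.1 p₁.2 ⟨a.1, _, a.2, hF⟩
    have h01 := hs 0 hn
    have hlast := hs (n - 1) (by omega)
    rw [Nat.sub_add_cancel hn, hsn] at hlast
    rw [zero_add, hs0] at h01
    rw [h01.eq_of_length_eq_one a.2 ha _ hF.1] at h01
    exact ⟨p₁, ⟨_, hlast.nonzero_left⟩, (pathBasis_isPerfectPair_iff hI).2 h01,
      (pathBasis_isPerfectPair_iff hI).2 hlast⟩
  · left
    intro p h1 h2
    exact hex ⟨p, h1, h2⟩

/-- An arrow `a` annihilated by a path from the right is itself perfect, and the two perfect pairs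
needed over the opposite algebra are the ones following `a` on its cycle. -/
theorem hasInjectiveDimensionLE_one_op (hI : IsMonomial I)
    (hC : ∀ p : QPath Q, IsNonzeroPath I p →
      (∃ (q : QPath Q) (h : q.tgt = p.src), IsNonzeroPath I q ∧
        p.concat q h ∈ minimalPaths I) → IsPerfectPath I p) :
    CategoryTheory.HasInjectiveDimensionLE
      (ModuleCat.of (QuotientAlgebra I)ᵐᵒᵖ (QuotientAlgebra I)ᵐᵒᵖ) 1 := by
  refine (pathBasis hI).op.hasInjectiveDimensionLE_one fun a ha => ?_
  by_cases hex : ∃ p, (pathBasis hI).op.src p = (pathBasis hI).op.tgt a ∧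
      (pathBasis hI).op.b p * (pathBasis hI).op.b a = 0
  · right
    obtain ⟨p, hp1, hp2⟩ := hex
    obtain ⟨p₁, hp₁⟩ := PathBasis.exists_isLeftMinimal hp1 hp2
    have hF := mem_minimalPaths_of_op_isLeftMinimal hI ha hp₁
    obtain ⟨n, s, hn, hs0, hsn, hs⟩ := hC a.1 a.2 ⟨p₁.1, _, p₁.2, hF⟩
    have h01 := hs 0 hn
    have hnext : ∃ q, IsPerfectPair I (s 1) q := by
      obtain rfl | hlt := eq_or_lt_of_le hn
      · -- the cycle consists of the arrow alone
        rw [zero_add, hs0, hsn] at h01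
        rw [hsn]
        exact ⟨_, h01⟩
      · exact ⟨_, hs 1 hlt⟩
    obtain ⟨q, hq⟩ := hnext
    rw [zero_add, hs0] at h01
    exact ⟨⟨s 1, hq.nonzero_left⟩, ⟨q, hq.nonzero_right⟩,
      ((pathBasis_isPerfectPair_iff hI (q := ⟨s 1, hq.nonzero_left⟩)).2 h01).op,
      ((pathBasis_isPerfectPair_iff hI (p := ⟨s 1, hq.nonzero_left⟩)
        (q := ⟨q, hq.nonzero_right⟩)).2 hq).op⟩
  · left
    intro p h1 h2
    exact hex ⟨p, h1, h2⟩

end Translation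

/-- The regular right module, as a left module over the opposite ring, is the regular module of the
opposite ring. -/
def opRegularEquiv (A : Type u) [Ring A] : Aᵐᵒᵖ ≃ₗ[Aᵐᵒᵖ] A where
  toFun := MulOpposite.unop
  invFun := MulOpposite.op
  left_inv _ := rfl
  right_inv _ := rfl
  map_add' _ _ := rfl
  map_smul' _ _ := rfl

end BoundQuiver

theorem theorem5p4 {k : Type w} [Field k] [IsAlgClosed k] {Q : Type u} [Quiver.{v} Q] [Fintype Q]
    [∀ a b : Q, Finite (a ⟶ b)] (I : TwoSidedIdeal (BoundQuiver.PathAlgebra k Q))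
    (hI : BoundQuiver.IsMonomial I) :
    BoundQuiver.IsDGorenstein 1 (BoundQuiver.QuotientAlgebra I) ↔
      ∀ p : BoundQuiver.QPath Q, BoundQuiver.IsNonzeroPath I p →
        (∃ (q : BoundQuiver.QPath Q) (h : q.tgt = p.src), BoundQuiver.IsNonzeroPath I q ∧
          p.concat q h ∈ BoundQuiver.minimalPaths I) →
        BoundQuiver.IsPerfectPath I p := by
  constructor
  · rintro ⟨hleft, -⟩ p hp ⟨q, h, hq, hF⟩
    have := hI.finite_nonzeroPath
    obtain ⟨n, s, hn, hs0, hsn, hs⟩ := (BoundQuiver.isLeftMinimal_of_mem_minimalPaths hI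
      (p := ⟨p, hp⟩) (q := ⟨q, hq⟩) h hF).exists_cycle hleft
    exact ⟨n, fun i => (s i).1, hn, congrArg Subtype.val hs0, congrArg Subtype.val hsn,
      fun i hi => (BoundQuiver.pathBasis_isPerfectPair_iff hI).1 (hs i hi)⟩
  · intro hC
    refine ⟨BoundQuiver.hasInjectiveDimensionLE_one_left hI hC, ?_⟩
    have := BoundQuiver.hasInjectiveDimensionLE_one_op hI hC
    exact CategoryTheory.hasInjectiveDimensionLT_of_iso
      (LinearEquiv.toModuleIso (BoundQuiver.opRegularEquiv _)) _
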